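/- Let $\lambda,c>0$ and $x_0\in\mathbb R$. For each $n\ge 1$ let $X^{(1)},\dots,X^{(n)}$ be independent and identically distributed Ornstein--Uhlenbeck processes, i.e. solutions of $$\mathrm dX_t=-\lambda X_t\,\mathrm dt+\mathrm dL_t\quad(t\ge 0),\qquad X_0=x_0,$$ driven by Lévy processes $L$ with $\mathbb E[e^{izL_1}]=e^{-c|z|^{2}}$ for all $z\in\mathbb R$ (the case $\alpha=2$; thus $L$ is $\sqrt{2c}$ times a standard Brownian motion). Put $\mathcal Z^{(n)}_t=\max_{1\le j\le n}X^{(j)}_t$. As $t\to\infty$, $X^{(j)}_t$ converges in distribution to a random variable $X_\infty$, and for each $n\ge1$, $\mathcal Z^{(n)}_t$ converges in total variation to $\mathcal Z^{(n)}_\infty$, the maximum of $n$ independent copies of $X_\infty$. Let $$d^{(n)}(t)=d_{\mathrm{TV}}\big(\mathcal Z^{(n)}_t,\mathcal Z^{(n)}_\infty\big),\qquad d_{\mathrm{TV}}(\nu_1,\nu_2)=\sup_F|\nu_1(F)-\nu_2(F)|,$$ where $F$ ranges over the measurable sets and the distance between random variables is that between their laws. Then the family $(\mathcal Z^{(n)})_{n\ge1}$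 has profile cut-off in total variation as $n\to\infty$, with cut-off time and time window $$t^{(n)}=\frac1{2\lambda}\ln\ln n,\qquad w^{(n)}=\kappa+o_n(1),$$ where $\kappa>0$ is any constant and $o_n(1)$ is any real sequence tending to $0$. That is, $t^{(n)}\to\infty$, $w^{(n)}/t^{(n)}\to0$, for every $b\in\mathbb R$ $$\lim_{n\to\infty}d^{(n)}\big(t^{(n)}+b\,w^{(n)}\big)=G(b):=d_{\mathrm{TV}}\Big(\sqrt{2\lambda/c}\;e^{-\lambda\kappa b}x_0-e^{-2\lambda\kappa b}+\xi,\ \xi\Big)\in[0,1],$$ where $\xi$ has the Gumbel distribution, $\mathbb P(\xi\le x)=e^{-e^{-x}}$, and $$\lim_{b\to-\infty}G(b)=1,\qquad \lim_{b\to\infty}G(b)=0.$$ (For $c=\tfrac12$, i.e. standard Brownian noise, $\sqrt{2\lambda/c}=2\sqrt\lambda$.) -/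

import Mathlib

open MeasureTheory ProbabilityTheory Filter Topology Set
open scoped NNReal

noncomputable section

/-- The total variation distance `sup_F |ν₁(F) - ν₂(F)|`, with `F` ranging over the measurable
sets. -/
def tvDist {S : Type*} [MeasurableSpace S] (ν₁ ν₂ : Measure S) : ℝ :=
  ⨆ F : {F : Set S // MeasurableSet F}, |ν₁.real F.1 - ν₂.real F.1|

/-- Right-continuous paths with left limits. -/
def IsCadlagPath (f : ℝ≥0 → ℝ) : Prop :=
  ∀ t : ℝ≥0, ContinuousWithinAt f (Ici t) t ∧ ∃ l : ℝ, Tendsto f (𝓝[<] t) (𝓝 l)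

/-- A one-dimensional Lévy process: it starts at `0`, has independent and stationary increments,
and almost surely càdlàg paths. (Stochastic continuity follows from these properties.) -/
structure IsLevyProcess {Ω : Type*} [MeasurableSpace Ω] (L : ℝ≥0 → Ω → ℝ) (P : Measure Ω) :
    Prop where
  measurable : ∀ t, Measurable (L t)
  zero : ∀ᵐ ω ∂P, L 0 ω = 0
  indep : HasIndepIncrements L P
  stationary : ∀ s t : ℝ≥0, P.map (fun ω => L (s + t) ω - L s ω) = P.map (L t)
  cadlag : ∀ᵐ ω ∂P, IsCadlagPath (fun t => L t ω)

/-- A Lévy process `L` such that `E[exp(i z L₁)] = exp(-c |z|^α)` for every real `z`. -/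
structure IsStableLevyProcess {Ω : Type*} [MeasurableSpace Ω] (α c : ℝ) (L : ℝ≥0 → Ω → ℝ)
    (P : Measure Ω) : Prop extends IsLevyProcess L P where
  charFun_one : ∀ z : ℝ, charFun (P.map (L 1)) z = Complex.exp ((-(c * |z| ^ α) : ℝ) : ℂ)

/-- `X` is a solution of `dX_t = -λ X_t dt + dL_t`, `X_0 = x₀`, that is, almost surely
`X_t = x₀ - λ ∫₀ᵗ X_s ds + L_t` for all `t ≥ 0`, the paths being integrable on bounded
intervals. -/
structure SolvesOU {Ω : Type*} [MeasurableSpace Ω] (lam x₀ : ℝ) (L X : ℝ≥0 → Ω → ℝ)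
    (P : Measure Ω) : Prop where
  measurable : ∀ t, Measurable (X t)
  equation : ∀ᵐ ω ∂P, ∀ t : ℝ≥0,
    IntervalIntegrable (fun s : ℝ => X s.toNNReal ω) volume 0 t ∧
      X t ω = x₀ - lam * (∫ s in (0 : ℝ)..t, X s.toNNReal ω) + L t ω

/-- `X` is an Ornstein-Uhlenbeck process started at `x₀` with drift parameter `lam`, driven by
some Lévy process `L` with `E[exp(i z L₁)] = exp(-c |z|^α)`. -/
def IsOUProcess {Ω : Type*} [MeasurableSpace Ω] (lam α c x₀ : ℝ) (X : ℝ≥0 → Ω → ℝ)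
    (P : Measure Ω) : Prop :=
  ∃ L : ℝ≥0 → Ω → ℝ, IsStableLevyProcess α c L P ∧ SolvesOU lam x₀ L X P

/-- The maximum of the coordinates of a vector (`0` for the empty vector). -/
def vecMax {n : ℕ} (x : Fin n → ℝ) : ℝ := ⨆ j, x j

/-- The law at time `t` of the maximum of the processes `X j`, `j : Fin n`. -/
def maxLaw {Ω : Type*} [MeasurableSpace Ω] {n : ℕ} (X : Fin n → ℝ≥0 → Ω → ℝ) (P : Measure Ω)
    (t : ℝ≥0) : Measure ℝ :=
  P.map (fun ω => vecMax (fun j => X j t ω))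

/-- The law of the maximum of `n` independent random variables with law `ν`. -/
def iidMaxLaw (n : ℕ) (ν : Measure ℝ) [SigmaFinite ν] : Measure ℝ :=
  (Measure.pi (fun _ : Fin n => ν)).map vecMax

/-- Profile cut-off of a family of distances `d n : [0, ∞) → ℝ`, with cut-off times `t n`, time
windows `w n` and profile function `G : ℝ → [0, 1]`. Since `w n / t n → 0` and `t n → ∞`, the time
`t n + b * w n` is positive for all large `n`. -/
structure HasProfileCutoff (d : ℕ → ℝ≥0 → ℝ) (t w : ℕ → ℝ) (G : ℝ → ℝ) : Prop where
  time : Tendsto t atTop atTop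
  window : Tendsto (fun n => w n / t n) atTop (𝓝 0)
  mem_Icc : ∀ b, G b ∈ Icc (0 : ℝ) 1
  profile : ∀ b : ℝ, Tendsto (fun n => d n (t n + b * w n).toNNReal) atTop (𝓝 (G b))
  atBot : Tendsto G atBot (𝓝 1)
  atTop : Tendsto G atTop (𝓝 0)

/-- The Gumbel distribution function `x ↦ exp(-exp(-x))`. -/
def gumbelCDF : StieltjesFunction ℝ where
  toFun x := Real.exp (-Real.exp (-x))
  mono' x y h := by
    have : Real.exp (-y) ≤ Real.exp (-x) := Real.exp_le_exp.2 (by linarith)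
    exact Real.exp_le_exp.2 (by linarith)
  right_continuous' x := Continuous.continuousWithinAt (by fun_prop)

/-- The Gumbel distribution. -/
def gumbel : Measure ℝ := gumbelCDF.measure

theorem tendsto_gumbelCDF_atBot : Tendsto gumbelCDF atBot (𝓝 0) :=
  Real.tendsto_exp_atBot.comp
    (tendsto_neg_atTop_atBot.comp (Real.tendsto_exp_atTop.comp tendsto_neg_atBot_atTop))

theorem tendsto_gumbelCDF_atTop : Tendsto gumbelCDF atTop (𝓝 1) := by
  have h : Tendsto (fun x : ℝ => Real.exp (-x)) atTop (𝓝 0) :=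
    Real.tendsto_exp_atBot.comp tendsto_neg_atTop_atBot
  have h2 := (Real.continuous_exp.tendsto _).comp h.neg
  rw [neg_zero, Real.exp_zero] at h2
  exact h2

instance isProbabilityMeasure_gumbel : IsProbabilityMeasure gumbel :=
  gumbelCDF.isProbabilityMeasure tendsto_gumbelCDF_atBot tendsto_gumbelCDF_atTop

theorem gumbel_Iic (x : ℝ) : gumbel (Iic x) = ENNReal.ofReal (Real.exp (-Real.exp (-x))) := by
  rw [gumbel, gumbelCDF.measure_Iic tendsto_gumbelCDF_atBot, sub_zero]
  rfl

/-- The function `b ↦ d_TV(√(2λ/c) e^{-λκb} x₀ - e^{-2λκb} + ξ, ξ)`, where `ξ` is Gumbel. -/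
def gumbelProfile (lam c x₀ κ b : ℝ) : ℝ :=
  tvDist
    (gumbel.map (fun ξ => √(2 * lam / c) * Real.exp (-(lam * κ * b)) * x₀
      - Real.exp (-(2 * lam * κ * b)) + ξ))
    gumbel

end

/-!
The Ornstein-Uhlenbeck process driven by `√(2c)` times Brownian motion is Gaussian at time `t`, with
mean `x₀ δ` and variance `(c / lam) (1 - δ ^ 2)`, where `δ = exp (-lam t)`
(`IsOUProcess.map_eq_gaussianReal`). Hence, with `M` the maximum of `n` independent standard Gaussian
variables and `q = x₀ / √(c / lam)`, the distance to equilibrium of the maximum is the total variation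
distance of `q δ + √(1 - δ ^ 2) M` and `M` (`tvDist_iidMaxLaw_gaussianReal`). For fixed `n` it
vanishes as `δ → 0` because `M` has a continuous density.

For the profile write `M = r - ℓ / r + ξₙ / r`, where `r = √(2 log n)` and `ℓ = log (√(2 π) r)`. By
affine invariance the distance is that of `Aₙ + √(1 - δ ^ 2) ξₙ` and `ξₙ`, where
`Aₙ = q r δ + (1 - √(1 - δ ^ 2)) (ℓ - r ^ 2)`. At the cut-off times `r δ` converges to
`ρ = √2 exp (-lam κ b)`, so `Aₙ → q ρ - ρ ^ 2 / 2`, the shift in the profile function. The densities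
of `ξₙ` converge to the Gumbel density, even along convergent arguments
(`tendsto_normalizedMaxDensity`), so Scheffé's lemma (`tendsto_tvDist_map_affine`) gives convergence
in total variation and the limit of the distances (`tendsto_maxDist_gumbel`).

The Gaussian law of the process is found as follows. The characteristic function of the Lévy process
at time `1 / n` is a continuous `n`-th root of `exp (-c z ^ 2)`, which determines all one-dimensional
laws (`IsStableLevyProcess.charFun_eq`). Variation of constants and summation by parts then write the
solution as an almost sure limit of weighted sums of increments of the Lévy process
(`tendsto_weighted_increments`), whose characteristic functions are explicit and converge.
-/

/-! ### Total variation distance -/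

section TotalVariation

variable {S : Type*} [MeasurableSpace S]

theorem abs_measureReal_sub_le_one (μ ν : Measure S) [IsProbabilityMeasure μ]
    [IsProbabilityMeasure ν] (F : Set S) : |μ.real F - ν.real F| ≤ 1 := by
  have h1 : μ.real F ≤ 1 := measureReal_le_one
  have h2 : ν.real F ≤ 1 := measureReal_le_one
  have h3 : 0 ≤ μ.real F := measureReal_nonneg
  have h4 : 0 ≤ ν.real F := measureReal_nonneg
  rw [abs_le]
  constructor <;> linarith

theorem abs_measureReal_sub_le_tvDist (μ ν : Measure S) [IsProbabilityMeasure μ]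
    [IsProbabilityMeasure ν] {F : Set S} (hF : MeasurableSet F) :
    |μ.real F - ν.real F| ≤ tvDist μ ν := by
  refine le_ciSup (f := fun F : {F : Set S // MeasurableSet F} => |μ.real F.1 - ν.real F.1|)
    ⟨1, ?_⟩ ⟨F, hF⟩
  rintro _ ⟨G, rfl⟩
  exact abs_measureReal_sub_le_one μ ν G.1

theorem tvDist_le {μ ν : Measure S} {a : ℝ}
    (h : ∀ F, MeasurableSet F → |μ.real F - ν.real F| ≤ a) : tvDist μ ν ≤ a :=
  haveI : Nonempty {F : Set S // MeasurableSet F} := ⟨⟨∅, MeasurableSet.empty⟩⟩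
  ciSup_le fun F => h F.1 F.2

theorem tvDist_nonneg (μ ν : Measure S) : 0 ≤ tvDist μ ν :=
  Real.iSup_nonneg fun _ => abs_nonneg _

theorem tvDist_le_one (μ ν : Measure S) [IsProbabilityMeasure μ] [IsProbabilityMeasure ν] :
    tvDist μ ν ≤ 1 :=
  tvDist_le fun F _ => abs_measureReal_sub_le_one μ ν F

theorem tvDist_comm (μ ν : Measure S) : tvDist μ ν = tvDist ν μ := by
  simp only [tvDist, abs_sub_comm]

theorem tvDist_triangle (μ ν ρ : Measure S) [IsProbabilityMeasure μ] [IsProbabilityMeasure ν]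
    [IsProbabilityMeasure ρ] : tvDist μ ρ ≤ tvDist μ ν + tvDist ν ρ :=
  tvDist_le fun _ hF => (abs_sub_le _ _ _).trans
    (add_le_add (abs_measureReal_sub_le_tvDist μ ν hF) (abs_measureReal_sub_le_tvDist ν ρ hF))

theorem tvDist_map_le {T : Type*} [MeasurableSpace T] (μ ν : Measure S)
    [IsProbabilityMeasure μ] [IsProbabilityMeasure ν] {f : S → T} (hf : Measurable f) :
    tvDist (μ.map f) (ν.map f) ≤ tvDist μ ν := by
  refine tvDist_le fun F hF => ?_
  rw [map_measureReal_apply hf hF, map_measureReal_apply hf hF]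
  exact abs_measureReal_sub_le_tvDist μ ν (hf hF)

theorem tvDist_map_of_leftInverse {T : Type*} [MeasurableSpace T] (μ ν : Measure S)
    [IsProbabilityMeasure μ] [IsProbabilityMeasure ν] {f : S → T} {g : T → S}
    (hf : Measurable f) (hg : Measurable g) (h : Function.LeftInverse g f) :
    tvDist (μ.map f) (ν.map f) = tvDist μ ν := by
  refine le_antisymm (tvDist_map_le μ ν hf) ?_
  have := Measure.isProbabilityMeasure_map (μ := μ) hf.aemeasurable
  have := Measure.isProbabilityMeasure_map (μ := ν) hf.aemeasurable
  simpa [Measure.map_map hg hf, h.comp_eq_id] using tvDist_map_le (μ.map f) (ν.map f) hg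

theorem tendsto_tvDist_of_tendsto_zero {ι : Type*} {l : Filter ι} (μ ν : ι → Measure S)
    (μ' ν' : Measure S) [∀ i, IsProbabilityMeasure (μ i)] [∀ i, IsProbabilityMeasure (ν i)]
    [IsProbabilityMeasure μ'] [IsProbabilityMeasure ν']
    (hμ : Tendsto (fun i => tvDist (μ i) μ') l (𝓝 0))
    (hν : Tendsto (fun i => tvDist (ν i) ν') l (𝓝 0)) :
    Tendsto (fun i => tvDist (μ i) (ν i)) l (𝓝 (tvDist μ' ν')) := by
  rw [tendsto_iff_dist_tendsto_zero]
  refine squeeze_zero (fun _ => dist_nonneg) (fun i => ?_) (by simpa using hμ.add hν)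
  rw [Real.dist_eq, abs_le]
  have h1 := tvDist_triangle μ' (μ i) ν'
  have h2 := tvDist_triangle (μ i) (ν i) ν'
  have h3 := tvDist_triangle (μ i) μ' (ν i)
  have h4 := tvDist_triangle μ' ν' (ν i)
  rw [tvDist_comm μ' (μ i)] at h1
  rw [tvDist_comm ν' (ν i)] at h4
  constructor <;> linarith

end TotalVariation

/-! ### Differentiable distribution functions and Scheffé's lemma -/

/-- The distribution function of `μ` is differentiable with derivative `f`. Such an `f` is a
probability density of `μ`, see `HasCDFDeriv.eq_withDensity`. -/
def HasCDFDeriv (μ : Measure ℝ) (f : ℝ → ℝ) : Prop :=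
  ∀ x, HasDerivAt (cdf μ) (f x) x

namespace HasCDFDeriv

variable {μ : Measure ℝ} {f : ℝ → ℝ}

theorem nonneg (h : HasCDFDeriv μ f) (x : ℝ) : 0 ≤ f x := by
  rw [← (h x).deriv]
  exact (monotone_cdf μ).deriv_nonneg

theorem measurable (h : HasCDFDeriv μ f) : Measurable f := by
  rw [show f = deriv (cdf μ) from funext fun x => (h x).deriv.symm]
  exact measurable_deriv _

theorem eq_withDensity [IsProbabilityMeasure μ] (h : HasCDFDeriv μ f) :
    μ = volume.withDensity fun x => ENNReal.ofReal (f x) := by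
  refine Measure.ext_of_Ioc _ _ fun a b hab => ?_
  have hcont : ContinuousOn (cdf μ) (Icc a b) := fun x _ =>
    (h x).continuousAt.continuousWithinAt
  have hint : IntegrableOn f (Ioc a b) :=
    intervalIntegral.integrableOn_deriv_of_nonneg hcont (fun x _ => h x) (fun x _ => h.nonneg x)
  have hsub : ∫ x in a..b, f x = cdf μ b - cdf μ a :=
    intervalIntegral.integral_eq_sub_of_hasDerivAt (fun x _ => h x)
      ((intervalIntegrable_iff_integrableOn_Ioc_of_le hab.le).2 hint)
  rw [withDensity_apply _ measurableSet_Ioc,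
    ← ofReal_integral_eq_lintegral_ofReal hint (ae_of_all _ h.nonneg),
    ← intervalIntegral.integral_of_le hab.le, hsub]
  conv_lhs => rw [← measure_cdf μ]
  exact (cdf μ).measure_Ioc a b

theorem integrable [IsProbabilityMeasure μ] (h : HasCDFDeriv μ f) : Integrable f := by
  refine ⟨h.measurable.aestronglyMeasurable, ?_⟩
  rw [hasFiniteIntegral_iff_ofReal (ae_of_all _ h.nonneg)]
  have h1 : μ univ = 1 := measure_univ
  rw [h.eq_withDensity, withDensity_apply _ MeasurableSet.univ, Measure.restrict_univ] at h1
  rw [h1]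
  exact ENNReal.one_lt_top

theorem measureReal_eq [IsProbabilityMeasure μ] (h : HasCDFDeriv μ f) {E : Set ℝ}
    (hE : MeasurableSet E) : μ.real E = ∫ x in E, f x := by
  rw [integral_eq_lintegral_of_nonneg_ae (ae_of_all _ h.nonneg)
    h.measurable.aestronglyMeasurable, ← withDensity_apply _ hE, ← h.eq_withDensity]
  rfl

end HasCDFDeriv

/-- **Scheffé's lemma**: pointwise convergence of probability densities implies convergence in
total variation. -/
theorem tendsto_tvDist_zero_of_tendsto_density {ι : Type*} {l : Filter ι}
    [l.IsCountablyGenerated] {μ : ι → Measure ℝ} [∀ i, IsProbabilityMeasure (μ i)]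
    {ν : Measure ℝ} [IsProbabilityMeasure ν] {f : ι → ℝ → ℝ} {g : ℝ → ℝ}
    (hμ : ∀ᶠ i in l, HasCDFDeriv (μ i) (f i)) (hν : HasCDFDeriv ν g)
    (h : ∀ x, Tendsto (fun i => f i x) l (𝓝 (g x))) :
    Tendsto (fun i => tvDist (μ i) ν) l (𝓝 0) := by
  -- Only the positive part of `g - f i` matters, and it is dominated by `g`.
  have hlim : Tendsto (fun i => ∫ x, max (g x - f i x) 0) l (𝓝 0) := by
    have := tendsto_integral_filter_of_dominated_convergence (μ := volume) (l := l)
      (F := fun i x => max (g x - f i x) 0) (f := fun _ => (0 : ℝ)) g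
      (by
        filter_upwards [hμ] with i hi
        exact ((hν.measurable.sub hi.measurable).max measurable_const).aestronglyMeasurable)
      (by
        filter_upwards [hμ] with i hi
        refine ae_of_all _ fun x => ?_
        rw [Real.norm_of_nonneg (le_max_right _ _)]
        exact max_le (by linarith [hi.nonneg x]) (hν.nonneg x))
      hν.integrable
      (ae_of_all _ fun x => by
        have h1 := ((tendsto_const_nhds (x := g x)).sub (h x)).max (tendsto_const_nhds (x := (0 : ℝ)))
        simpa using h1)
    simpa using this
  refine squeeze_zero' (Eventually.of_forall fun i => tvDist_nonneg _ _) ?_ hlim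
  filter_upwards [hμ] with i hi
  have hpos : Integrable (fun x => max (g x - f i x) 0) := (hν.integrable.sub hi.integrable).pos_part
  have hle : ∀ F, MeasurableSet F → ν.real F - (μ i).real F ≤ ∫ x, max (g x - f i x) 0 := by
    intro F hF
    rw [hν.measureReal_eq hF, hi.measureReal_eq hF,
      ← integral_sub hν.integrable.integrableOn hi.integrable.integrableOn]
    calc ∫ x in F, (g x - f i x) ≤ ∫ x in F, max (g x - f i x) 0 :=
          integral_mono (hν.integrable.sub hi.integrable).integrableOn hpos.integrableOn
            fun x => le_max_left _ _
      _ ≤ ∫ x, max (g x - f i x) 0 :=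
          setIntegral_le_integral hpos (ae_of_all _ fun x => le_max_right _ _)
  refine tvDist_le fun F hF => abs_le.2 ⟨by linarith [hle F hF], ?_⟩
  have := hle Fᶜ hF.compl
  rw [probReal_compl_eq_one_sub hF, probReal_compl_eq_one_sub hF] at this
  linarith

theorem cdf_map_affine (μ : Measure ℝ) [IsProbabilityMeasure μ] (A : ℝ) {s : ℝ} (hs : 0 < s)
    (x : ℝ) : cdf (μ.map fun y => A + s * y) x = cdf μ ((x - A) / s) := by
  have hm : Measurable fun y : ℝ => A + s * y := by fun_prop
  have := Measure.isProbabilityMeasure_map (μ := μ) hm.aemeasurable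
  rw [cdf_eq_real, cdf_eq_real, map_measureReal_apply hm measurableSet_Iic]
  congr 1
  ext y
  simp only [mem_preimage, mem_Iic]
  rw [le_div_iff₀ hs]
  constructor <;> intro h <;> linarith

theorem HasCDFDeriv.map_affine {μ : Measure ℝ} [IsProbabilityMeasure μ] {f : ℝ → ℝ}
    (h : HasCDFDeriv μ f) (A : ℝ) {s : ℝ} (hs : 0 < s) :
    HasCDFDeriv (μ.map fun y => A + s * y) fun x => f ((x - A) / s) / s := by
  intro x
  have h1 : (cdf (μ.map fun y => A + s * y) : ℝ → ℝ) = fun x => cdf μ ((x - A) / s) :=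
    funext (cdf_map_affine μ A hs)
  rw [h1]
  have h2 : HasDerivAt (fun x : ℝ => (x - A) / s) (1 / s) x :=
    ((hasDerivAt_id x).sub_const A).div_const s
  have h3 := HasDerivAt.comp x (h ((x - A) / s)) h2
  rwa [mul_one_div] at h3

/-- Scheffé's lemma for random variables `A i + s i * Z i` with `A i → a` and `s i → 1`. The
densities of `Z i` are assumed to converge along every convergent sequence of arguments, because the
density of `A i + s i * Z i` at `x` is that of `Z i` at the moving point `(x - A i) / s i`. -/
theorem tendsto_tvDist_map_affine {ι : Type*} {l : Filter ι}
    [l.IsCountablyGenerated] {μ : ι → Measure ℝ} [∀ i, IsProbabilityMeasure (μ i)]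
    {ν : Measure ℝ} [IsProbabilityMeasure ν] {f : ι → ℝ → ℝ} {g : ℝ → ℝ}
    (hμ : ∀ᶠ i in l, HasCDFDeriv (μ i) (f i)) (hν : HasCDFDeriv ν g)
    (h : ∀ (u : ι → ℝ) (x : ℝ), Tendsto u l (𝓝 x) → Tendsto (fun i => f i (u i)) l (𝓝 (g x)))
    {A s : ι → ℝ} {a : ℝ} (hA : Tendsto A l (𝓝 a)) (hs : Tendsto s l (𝓝 1)) :
    Tendsto (fun i => tvDist ((μ i).map fun y => A i + s i * y) (ν.map fun y => a + y)) l
      (𝓝 0) := by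
  have hm (a s : ℝ) : Measurable fun y : ℝ => a + s * y := by fun_prop
  have := fun i => Measure.isProbabilityMeasure_map (μ := μ i) (hm (A i) (s i)).aemeasurable
  have := Measure.isProbabilityMeasure_map (μ := ν) (hm a 1).aemeasurable
  have hpos : ∀ᶠ i in l, 0 < s i := hs.eventually (lt_mem_nhds one_pos)
  have key := tendsto_tvDist_zero_of_tendsto_density (l := l)
    (μ := fun i => (μ i).map fun y => A i + s i * y) (ν := ν.map fun y => a + 1 * y)
    (f := fun i x => f i ((x - A i) / s i) / s i) (g := fun x => g ((x - a) / 1) / 1)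
    (by filter_upwards [hμ, hpos] with i hi hsi using hi.map_affine (A i) hsi)
    (hν.map_affine a one_pos)
    (fun x => (h _ _ ((tendsto_const_nhds.sub hA).div hs one_ne_zero)).div hs one_ne_zero)
  simpa only [one_mul] using key

/-! ### Maxima of independent variables -/

theorem measurable_vecMax (n : ℕ) : Measurable (vecMax (n := n)) := by
  unfold vecMax
  fun_prop

instance (n : ℕ) (ν : Measure ℝ) [IsProbabilityMeasure ν] :
    IsProbabilityMeasure (iidMaxLaw n ν) :=
  Measure.isProbabilityMeasure_map (measurable_vecMax n).aemeasurable

theorem cdf_iidMaxLaw {n : ℕ} (hn : 1 ≤ n) (ν : Measure ℝ) [IsProbabilityMeasure ν] (x : ℝ) :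
    cdf (iidMaxLaw n ν) x = cdf ν x ^ n := by
  have : Nonempty (Fin n) := ⟨⟨0, hn⟩⟩
  rw [cdf_eq_real, cdf_eq_real, iidMaxLaw,
    map_measureReal_apply (measurable_vecMax n) measurableSet_Iic]
  have : vecMax ⁻¹' (Iic x) = univ.pi fun _ : Fin n => Iic x := by
    ext y
    simp [vecMax, ciSup_le_iff (Set.finite_range y).bddAbove, Pi.le_def]
  rw [this, measureReal_def, Measure.pi_pi]
  simp [measureReal_def]

theorem iidMaxLaw_map_affine {n : ℕ} (hn : 1 ≤ n) (ν : Measure ℝ) [IsProbabilityMeasure ν]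
    (A : ℝ) {s : ℝ} (hs : 0 < s) [SigmaFinite (ν.map fun y => A + s * y)] :
    iidMaxLaw n (ν.map fun y => A + s * y) = (iidMaxLaw n ν).map fun y => A + s * y := by
  have hm : Measurable fun y : ℝ => A + s * y := by fun_prop
  have := Measure.isProbabilityMeasure_map (μ := ν) hm.aemeasurable
  have := Measure.isProbabilityMeasure_map (μ := iidMaxLaw n ν) hm.aemeasurable
  refine Measure.eq_of_cdf _ _ (StieltjesFunction.ext fun x => ?_)
  rw [cdf_iidMaxLaw hn, cdf_map_affine _ _ hs, cdf_map_affine _ _ hs, cdf_iidMaxLaw hn]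

theorem HasCDFDeriv.iidMaxLaw {n : ℕ} (hn : 1 ≤ n) {ν : Measure ℝ} [IsProbabilityMeasure ν]
    {f : ℝ → ℝ} (h : HasCDFDeriv ν f) :
    HasCDFDeriv (iidMaxLaw n ν) fun x => n * cdf ν x ^ (n - 1) * f x := by
  intro x
  have h1 : (cdf (_root_.iidMaxLaw n ν) : ℝ → ℝ) = fun x => cdf ν x ^ n :=
    funext (cdf_iidMaxLaw hn ν)
  rw [h1]
  exact (h x).pow n

/-! ### The Gumbel limit of Gaussian maxima -/

theorem gaussianPDFReal_zero_one (x : ℝ) :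
    gaussianPDFReal 0 1 x = (√(2 * Real.pi))⁻¹ * Real.exp (-(x ^ 2 / 2)) := by
  simp [gaussianPDFReal, neg_div]

theorem hasCDFDeriv_gaussianReal : HasCDFDeriv (gaussianReal 0 1) (gaussianPDFReal 0 1) := by
  intro x
  have hint : Integrable (gaussianPDFReal 0 1) := integrable_gaussianPDFReal 0 1
  have hcont : Continuous (gaussianPDFReal 0 1) := by unfold gaussianPDFReal; fun_prop
  have h1 : (cdf (gaussianReal 0 1) : ℝ → ℝ) =
      fun x => (∫ y in Iic 0, gaussianPDFReal 0 1 y) + ∫ y in (0 : ℝ)..x, gaussianPDFReal 0 1 y := by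
    ext x
    rw [cdf_eq_real, measureReal_def, gaussianReal_apply_eq_integral 0 one_ne_zero,
      ENNReal.toReal_ofReal (integral_nonneg fun y => gaussianPDFReal_nonneg 0 1 y),
      ← intervalIntegral.integral_Iic_sub_Iic hint.integrableOn hint.integrableOn,
      add_sub_cancel]
  rw [h1]
  exact (hcont.integral_hasStrictDerivAt 0 x).hasDerivAt.const_add _

theorem hasCDFDeriv_gumbel :
    HasCDFDeriv gumbel fun x => Real.exp (-x) * Real.exp (-Real.exp (-x)) := by
  intro x
  have h1 : (cdf gumbel : ℝ → ℝ) = fun x => Real.exp (-Real.exp (-x)) := by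
    ext x
    rw [cdf_eq_real, measureReal_def, gumbel_Iic, ENNReal.toReal_ofReal (Real.exp_pos _).le]
  rw [h1]
  have h2 : HasDerivAt (fun x : ℝ => Real.exp (-x)) (-Real.exp (-x)) x := by
    simpa using (hasDerivAt_neg x).exp
  have h3 : HasDerivAt (fun x : ℝ => Real.exp (-Real.exp (-x)))
      (Real.exp (-Real.exp (-x)) * -(-Real.exp (-x))) x := h2.fun_neg.exp
  rwa [neg_neg, mul_comm] at h3

/-- The normalizing factor `r = √(2 log n)` in the Gumbel limit for Gaussian maxima. -/
noncomputable def maxRate (n : ℕ) : ℝ := √(2 * Real.log n)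

/-- The correction `ℓ = log (√(2 π) r)` in the centring `r - ℓ / r` of Gaussian maxima, where
`r = maxRate n`. -/
noncomputable def maxCorr (n : ℕ) : ℝ := Real.log (√(2 * Real.pi) * maxRate n)

theorem tendsto_maxRate : Tendsto maxRate atTop atTop :=
  Real.tendsto_sqrt_atTop.comp
    ((Real.tendsto_log_atTop.comp tendsto_natCast_atTop_atTop).const_mul_atTop two_pos)

theorem tendsto_maxCorr_div : Tendsto (fun n => maxCorr n / maxRate n) atTop (𝓝 0) := by
  have hpi : 0 < √(2 * Real.pi) := by positivity
  have h1 : Tendsto (fun n => √(2 * Real.pi) * maxRate n) atTop atTop :=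
    tendsto_maxRate.const_mul_atTop hpi
  have h2 := (Real.isLittleO_log_id_atTop.tendsto_div_nhds_zero.comp h1).mul_const (√(2 * Real.pi))
  rw [zero_mul] at h2
  refine h2.congr fun n => ?_
  simp only [Function.comp, id, maxCorr]
  field_simp

/-- The normalized variable `r (M - (r - ℓ / r))`, where `r = maxRate n`, `ℓ = maxCorr n` and `M`
is the maximum of `n` independent standard Gaussian variables. -/
noncomputable def normalizedMaxLaw (n : ℕ) : Measure ℝ :=
  (iidMaxLaw n (gaussianReal 0 1)).map fun y => (maxCorr n - maxRate n ^ 2) + maxRate n * y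

instance (n : ℕ) : IsProbabilityMeasure (normalizedMaxLaw n) :=
  Measure.isProbabilityMeasure_map (by fun_prop)

/-- The mean density `n φ(u) / r` at `x` of the `n` normalized Gaussian points, where
`u = r + (x - ℓ) / r`, is `exp (-x)` up to a factor at most `1` that tends to `1`: the equalities
`n = exp (r ^ 2 / 2)` and `√(2 π) r = exp ℓ` make this an identity. -/
theorem gaussian_intensity {n : ℕ} (hn : 1 ≤ n) (hr : 0 < maxRate n) (x : ℝ) :
    n * (gaussianPDFReal 0 1 ((x - (maxCorr n - maxRate n ^ 2)) / maxRate n) / maxRate n) =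
      Real.exp (-x) * Real.exp (-((x / maxRate n - maxCorr n / maxRate n) ^ 2 / 2)) := by
  have hpi : 0 < √(2 * Real.pi) := by positivity
  have hn' : (0 : ℝ) < n := by exact_mod_cast hn
  have hlog : 0 ≤ Real.log n := Real.log_nonneg (by exact_mod_cast hn)
  set r := maxRate n with hrdef
  have hnr : (n : ℝ) = Real.exp (r ^ 2 / 2) := by
    rw [hrdef, maxRate, Real.sq_sqrt (by positivity), mul_div_cancel_left₀ _ two_ne_zero,
      Real.exp_log hn']
  have hl : √(2 * Real.pi) * r = Real.exp (maxCorr n) := by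
    rw [maxCorr, Real.exp_log (by positivity)]
  rw [gaussianPDFReal_zero_one, hnr, mul_comm _⁻¹, mul_div_assoc, ← one_div, div_div, hl, one_div,
    ← Real.exp_neg, ← Real.exp_add, ← Real.exp_add, ← Real.exp_add]
  congr 1
  field_simp
  ring

/-- The expected number `n (1 - Φ)` of normalized points above `x` converges to `exp (-x)`. It is the
integral over `(x, ∞)` of the mean density of `gaussian_intensity`, which `exp (-x)` dominates. -/
theorem tendsto_gaussian_tail {u : ℕ → ℝ} {x : ℝ} (hu : Tendsto u atTop (𝓝 x)) :
    Tendsto (fun n : ℕ => (n : ℝ) *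
      (cdf (gaussianReal 0 1) ((u n - (maxCorr n - maxRate n ^ 2)) / maxRate n) - 1))
      atTop (𝓝 (-Real.exp (-x))) := by
  set h : ℕ → ℝ → ℝ := fun n y =>
    Real.exp (-y) * Real.exp (-((y / maxRate n - maxCorr n / maxRate n) ^ 2 / 2)) with hh
  have hlim : Tendsto (fun n => ∫ y, (Ioi (u n)).indicator (h n) y) atTop
      (𝓝 (∫ y, (Ioi x).indicator (fun y => Real.exp (-y)) y)) := by
    refine tendsto_integral_filter_of_dominated_convergence
      ((Ioi (x - 1)).indicator fun y => Real.exp (-y)) ?_ ?_ ?_ ?_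
    · refine Eventually.of_forall fun n => ?_
      have : Measurable (h n) := by fun_prop
      exact (this.indicator measurableSet_Ioi).aestronglyMeasurable
    · filter_upwards [hu.eventually (lt_mem_nhds (sub_one_lt x))] with n hn
      refine ae_of_all _ fun y => ?_
      by_cases hy : u n < y
      · rw [indicator_of_mem (show y ∈ Ioi (u n) from hy),
          indicator_of_mem (show y ∈ Ioi (x - 1) from hn.trans hy),
          Real.norm_of_nonneg (by positivity)]
        refine mul_le_of_le_one_right (Real.exp_pos _).le (Real.exp_le_one_iff.2 ?_)
        exact neg_nonpos.2 (by positivity)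
      · rw [indicator_of_notMem (show y ∉ Ioi (u n) from hy), norm_zero]
        exact indicator_nonneg (fun _ _ => (Real.exp_pos _).le) _
    · exact (integrable_indicator_iff measurableSet_Ioi).2 (integrableOn_exp_neg_Ioi (x - 1))
    · filter_upwards [Measure.ae_ne volume x] with y hy
      have hlimy : Tendsto (fun n => h n y) atTop (𝓝 (Real.exp (-y))) := by
        have h1 := (tendsto_maxRate.const_div_atTop y).sub tendsto_maxCorr_div
        have h2 := (h1.pow 2).div_const 2
        have h3 := ((Real.continuous_exp.tendsto _).comp h2.neg).const_mul (Real.exp (-y))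
        simpa using h3
      rcases lt_or_gt_of_ne hy with hy | hy
      · rw [indicator_of_notMem (show y ∉ Ioi x from not_lt.2 hy.le)]
        refine tendsto_const_nhds.congr' ?_
        filter_upwards [hu.eventually (lt_mem_nhds hy)] with n hn
        rw [indicator_of_notMem (show y ∉ Ioi (u n) from not_lt.2 hn.le)]
      · rw [indicator_of_mem (show y ∈ Ioi x from hy)]
        refine hlimy.congr' ?_
        filter_upwards [hu.eventually (gt_mem_nhds hy)] with n hn
        rw [indicator_of_mem (show y ∈ Ioi (u n) from hn)]
  simp_rw [integral_indicator measurableSet_Ioi] at hlim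
  rw [integral_exp_neg_Ioi] at hlim
  refine hlim.neg.congr' ?_
  filter_upwards [tendsto_maxRate.eventually_gt_atTop 0, eventually_ge_atTop 1] with n hr hn
  set A := maxCorr n - maxRate n ^ 2
  have hm : Measurable fun y : ℝ => A + maxRate n * y := by fun_prop
  have := Measure.isProbabilityMeasure_map (μ := gaussianReal 0 1) hm.aemeasurable
  have h1 := (hasCDFDeriv_gaussianReal.map_affine A hr).measureReal_eq
    (measurableSet_Ioi (a := u n))
  have h2 : ∫ y in Ioi (u n), h n y = ∫ y in Ioi (u n),
      n * (gaussianPDFReal 0 1 ((y - A) / maxRate n) / maxRate n) :=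
    integral_congr_ae (ae_of_all _ fun y => (gaussian_intensity hn hr y).symm)
  rw [h2, integral_const_mul, ← h1, ← compl_Iic, probReal_compl_eq_one_sub measurableSet_Iic,
    ← cdf_eq_real, cdf_map_affine _ _ hr]
  ring

/-- The density of `normalizedMaxLaw n` (for large `n`), see `hasCDFDeriv_normalizedMaxLaw`. -/
noncomputable def normalizedMaxDensity (n : ℕ) (x : ℝ) : ℝ :=
  n * cdf (gaussianReal 0 1) ((x - (maxCorr n - maxRate n ^ 2)) / maxRate n) ^ (n - 1) *
    gaussianPDFReal 0 1 ((x - (maxCorr n - maxRate n ^ 2)) / maxRate n) / maxRate n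

theorem hasCDFDeriv_normalizedMaxLaw {n : ℕ} (hn : 1 ≤ n) (hr : 0 < maxRate n) :
    HasCDFDeriv (normalizedMaxLaw n) (normalizedMaxDensity n) :=
  (hasCDFDeriv_gaussianReal.iidMaxLaw hn).map_affine _ hr

/-- The densities of normalized Gaussian maxima converge continuously to the Gumbel density. -/
theorem tendsto_normalizedMaxDensity (u : ℕ → ℝ) (x : ℝ) (hu : Tendsto u atTop (𝓝 x)) :
    Tendsto (fun n => normalizedMaxDensity n (u n)) atTop
      (𝓝 (Real.exp (-x) * Real.exp (-Real.exp (-x)))) := by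
  set p : ℕ → ℝ := fun n =>
    cdf (gaussianReal 0 1) ((u n - (maxCorr n - maxRate n ^ 2)) / maxRate n) with hp
  have htail : Tendsto (fun n : ℕ => (n : ℝ) * (p n - 1)) atTop (𝓝 (-Real.exp (-x))) :=
    tendsto_gaussian_tail hu
  have hp1 : Tendsto p atTop (𝓝 1) := by
    have h1 := htail.mul tendsto_inv_atTop_nhds_zero_nat
    rw [mul_zero] at h1
    have h2 := h1.add_const 1
    rw [zero_add] at h2
    refine h2.congr' ?_
    filter_upwards [eventually_ge_atTop 1] with n hn
    have : (n : ℝ) ≠ 0 := by positivity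
    field_simp
    ring
  have hpow : Tendsto (fun n => p n ^ n) atTop (𝓝 (Real.exp (-Real.exp (-x)))) := by
    simpa using Real.tendsto_one_add_pow_exp_of_tendsto htail
  have hpow' : Tendsto (fun n => p n ^ (n - 1)) atTop (𝓝 (Real.exp (-Real.exp (-x)))) := by
    have h1 := hpow.div hp1 one_ne_zero
    rw [div_one] at h1
    refine h1.congr' ?_
    filter_upwards [eventually_ge_atTop 1, hp1.eventually_ne one_ne_zero] with n hn hpn
    rw [Pi.div_apply, div_eq_iff hpn, ← pow_succ, Nat.sub_add_cancel hn]
  have hint : Tendsto (fun n => Real.exp (-u n) *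
      Real.exp (-((u n / maxRate n - maxCorr n / maxRate n) ^ 2 / 2))) atTop
      (𝓝 (Real.exp (-x))) := by
    have h1 := (hu.div_atTop tendsto_maxRate).sub tendsto_maxCorr_div
    have h2 := (h1.pow 2).div_const 2
    have h3 := ((Real.continuous_exp.tendsto _).comp hu.neg).mul
      ((Real.continuous_exp.tendsto _).comp h2.neg)
    simpa using h3
  refine (hint.mul hpow').congr' ?_
  filter_upwards [tendsto_maxRate.eventually_gt_atTop 0, eventually_ge_atTop 1] with n hr hn
  rw [← gaussian_intensity hn hr, normalizedMaxDensity]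
  ring

/-! ### Càdlàg paths and the pathwise solution of the equation -/

theorem IsCadlagPath.exists_bound {f : ℝ≥0 → ℝ} (hf : IsCadlagPath f) (T : ℝ≥0) :
    ∃ C : ℝ, ∀ s ≤ T, |f s| ≤ C := by
  have hK : IsCompact (Icc 0 T) := isCompact_Icc
  obtain ⟨C, hC⟩ := hK.induction_on (p := fun S => ∃ C : ℝ, ∀ s ∈ S, |f s| ≤ C) ⟨0, by simp⟩
    (fun S S' h ⟨C, hC⟩ => ⟨C, fun s hs => hC s (h hs)⟩)
    (fun S S' ⟨C, hC⟩ ⟨C', hC'⟩ => ⟨max C C', fun s hs => hs.elim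
      (fun h => (hC s h).trans (le_max_left _ _)) fun h => (hC' s h).trans (le_max_right _ _)⟩)
    (fun t _ => by
      obtain ⟨hr, l, hl⟩ := hf t
      have h1 : ∀ᶠ s in 𝓝[<] t, |f s| < |l| + 1 := hl.abs.eventually (gt_mem_nhds (lt_add_one _))
      have h2 : ∀ᶠ s in 𝓝[≥] t, |f s| < |f t| + 1 :=
        hr.tendsto.abs.eventually (gt_mem_nhds (lt_add_one _))
      have h3 : ∀ᶠ s in 𝓝 t, |f s| ≤ max (|l| + 1) (|f t| + 1) := by
        rw [← nhdsLT_sup_nhdsGE, eventually_sup]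
        exact ⟨h1.mono fun s hs => hs.le.trans (le_max_left _ _),
          h2.mono fun s hs => hs.le.trans (le_max_right _ _)⟩
      exact ⟨_, mem_nhdsWithin_of_mem_nhds h3, _, fun s hs => hs⟩)
  exact ⟨C, fun s hs => hC s ⟨zero_le, hs⟩⟩

theorem IsCadlagPath.continuousWithinAt_toNNReal {f : ℝ≥0 → ℝ} (hf : IsCadlagPath f) (s : ℝ) :
    ContinuousWithinAt (fun u : ℝ => f u.toNNReal) (Ici s) s :=
  (hf s.toNNReal).1.comp continuous_real_toNNReal.continuousWithinAt
    fun _ hu => Real.toNNReal_le_toNNReal hu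

/-- Riemann sums with right endpoints of a bounded right-continuous function converge. No
measurability of `f` is assumed: it is an almost everywhere limit of step functions. -/
theorem tendsto_riemannSum_of_rightContinuous {f G w : ℝ → ℝ} {t C : ℝ} (ht : 0 ≤ t)
    (hf : ∀ s, 0 ≤ s → ContinuousWithinAt f (Ici s) s) (hC : ∀ s ∈ Icc 0 t, |f s| ≤ C)
    (hG : ∀ s, HasDerivAt G (w s) s) (hw : Continuous w) :
    Tendsto (fun N : ℕ => ∑ k ∈ Finset.range N,
      (G ((k + 1) * (t / N)) - G (k * (t / N))) * f ((k + 1) * (t / N))) atTop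
      (𝓝 (∫ s in 0..t, w s * f s)) := by
  rcases ht.eq_or_lt with rfl | ht
  · simp
  have hgrid : ∀ N : ℕ, 1 ≤ N → 0 < t / N := fun N hN => by
    have : (0 : ℝ) < N := by exact_mod_cast hN
    positivity
  -- The Riemann sum is the integral of `w` against the step function `s ↦ f (⌈s / h⌉ h)`.
  have hmeas : ∀ N : ℕ, Measurable fun s : ℝ => f (⌈s / (t / N)⌉ * (t / N)) := fun N =>
    (measurable_of_countable fun m : ℤ => f (m * (t / N))).comp
      (Int.measurable_ceil.comp (measurable_id.div_const _))
  have hceil : ∀ N : ℕ, 1 ≤ N → ∀ s ∈ Ioc 0 t,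
      s ≤ ⌈s / (t / N)⌉ * (t / N) ∧ ⌈s / (t / N)⌉ * (t / N) ≤ s + t / N ∧
        ⌈s / (t / N)⌉ * (t / N) ≤ t := by
    intro N hN s hs
    have h := hgrid N hN
    have hN' : (N : ℝ) ≠ 0 := by positivity
    refine ⟨(div_le_iff₀ h).1 (Int.le_ceil _), ?_, ?_⟩
    · have := mul_le_mul_of_nonneg_right (Int.ceil_lt_add_one (s / (t / N))).le h.le
      rwa [add_mul, one_mul, div_mul_cancel₀ _ h.ne'] at this
    · have h1 : ⌈s / (t / N)⌉ ≤ (N : ℤ) := by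
        rw [Int.ceil_le, Int.cast_natCast, div_le_iff₀ h, mul_div_cancel₀ _ hN']
        exact hs.2
      have h2 : ((⌈s / (t / N)⌉ : ℤ) : ℝ) ≤ N := by exact_mod_cast h1
      have := mul_le_mul_of_nonneg_right h2 h.le
      rwa [mul_div_cancel₀ _ hN'] at this
  have hbound : ∀ N : ℕ, 1 ≤ N → ∀ s ∈ Ioc 0 t,
      ‖w s * f (⌈s / (t / N)⌉ * (t / N))‖ ≤ |w s| * C := by
    intro N hN s hs
    obtain ⟨h1, -, h3⟩ := hceil N hN s hs
    rw [norm_mul, Real.norm_eq_abs, Real.norm_eq_abs]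
    exact mul_le_mul_of_nonneg_left (hC _ ⟨hs.1.le.trans h1, h3⟩) (abs_nonneg _)
  have hdom : IntervalIntegrable (fun s => |w s| * C) volume 0 t :=
    (hw.abs.mul continuous_const).intervalIntegrable _ _
  have hsum : ∀ N : ℕ, 1 ≤ N → ∑ k ∈ Finset.range N,
      (G ((k + 1) * (t / N)) - G (k * (t / N))) * f ((k + 1) * (t / N)) =
      ∫ s in 0..t, w s * f (⌈s / (t / N)⌉ * (t / N)) := by
    intro N hN
    have h := hgrid N hN
    have hN' : (N : ℝ) ≠ 0 := by positivity
    have hint : IntervalIntegrable (fun s => w s * f (⌈s / (t / N)⌉ * (t / N))) volume 0 t := by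
      refine hdom.mono_fun' (hw.measurable.mul (hmeas N)).aestronglyMeasurable ?_
      rw [uIoc_of_le ht.le]
      exact (ae_restrict_iff' measurableSet_Ioc).2 (ae_of_all _ (hbound N hN))
    have hadj := intervalIntegral.sum_integral_adjacent_intervals
      (f := fun s => w s * f (⌈s / (t / N)⌉ * (t / N))) (μ := volume)
      (a := fun k : ℕ => (k : ℝ) * (t / N)) (n := N) (fun k hk => hint.mono_set (by
        rw [uIcc_of_le ht.le]
        refine uIcc_subset_Icc ⟨by positivity, ?_⟩ ⟨by positivity, ?_⟩
        · calc (k : ℝ) * (t / N) ≤ N * (t / N) := by gcongr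
            _ = t := mul_div_cancel₀ _ hN'
        · calc ((k + 1 : ℕ) : ℝ) * (t / N) ≤ N * (t / N) := by gcongr; exact_mod_cast hk
            _ = t := mul_div_cancel₀ _ hN'))
    simp only [Nat.cast_zero, zero_mul, mul_div_cancel₀ _ hN'] at hadj
    rw [← hadj]
    refine Finset.sum_congr rfl fun k _ => ?_
    have hle : (k : ℝ) * (t / N) ≤ ((k + 1 : ℕ) : ℝ) * (t / N) := by gcongr; simp
    have hconst : ∀ᵐ s, s ∈ uIoc ((k : ℝ) * (t / N)) (((k + 1 : ℕ) : ℝ) * (t / N)) →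
        w s * f (⌈s / (t / N)⌉ * (t / N)) = w s * f ((k + 1) * (t / N)) := by
      refine ae_of_all _ fun s hs => ?_
      rw [uIoc_of_le hle] at hs
      have : ⌈s / (t / N)⌉ = (k : ℤ) + 1 := by
        rw [Int.ceil_eq_iff, lt_div_iff₀ h, div_le_iff₀ h]
        push_cast
        refine ⟨by simpa using hs.1, by simpa using hs.2⟩
      rw [this]
      push_cast
      rfl
    rw [intervalIntegral.integral_congr_ae hconst, intervalIntegral.integral_mul_const,
      intervalIntegral.integral_eq_sub_of_hasDerivAt (fun s _ => hG s)
        (hw.intervalIntegrable _ _)]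
    push_cast
    rfl
  have hlim := intervalIntegral.tendsto_integral_filter_of_dominated_convergence
    (μ := volume) (a := 0) (b := t) (l := atTop)
    (F := fun (N : ℕ) s => w s * f (⌈s / (t / N)⌉ * (t / N))) (f := fun s => w s * f s)
    (fun s => |w s| * C)
    (Eventually.of_forall fun N => (hw.measurable.mul (hmeas N)).aestronglyMeasurable)
    (by
      filter_upwards [eventually_ge_atTop 1] with N hN
      rw [uIoc_of_le ht.le]
      exact ae_of_all _ (hbound N hN))
    hdom
    (by
      rw [uIoc_of_le ht.le]
      refine ae_of_all _ fun s hs => ?_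
      refine Tendsto.const_mul _ ((hf s hs.1.le).tendsto.comp (tendsto_nhdsWithin_iff.2 ⟨?_, ?_⟩))
      · have h1 : Tendsto (fun N : ℕ => s + t / N) atTop (𝓝 s) := by
          simpa using (tendsto_const_div_atTop_nhds_zero_nat t).const_add s
        refine tendsto_of_tendsto_of_tendsto_of_le_of_le' tendsto_const_nhds h1 ?_ ?_
        · filter_upwards [eventually_ge_atTop 1] with N hN using (hceil N hN s hs).1
        · filter_upwards [eventually_ge_atTop 1] with N hN using (hceil N hN s hs).2.1
      · filter_upwards [eventually_ge_atTop 1] with N hN using (hceil N hN s hs).1)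
  refine hlim.congr' ?_
  filter_upwards [eventually_ge_atTop 1] with N hN using (hsum N hN).symm

/-- Variation of constants: a solution of `x t = x₀ - lam ∫₀ᵗ x + l t` with càdlàg `l`. The
primitive `y` of `x` has right derivative `x` everywhere, so `exp (lam t) y t` can be computed by
integrating its right derivative `exp (lam t) (x₀ + l t)`. -/
theorem eq_of_integral_equation {x l : ℝ≥0 → ℝ} {lam x₀ : ℝ} (hl : IsCadlagPath l)
    (h : ∀ t : ℝ≥0, IntervalIntegrable (fun s : ℝ => x s.toNNReal) volume 0 t ∧
      x t = x₀ - lam * (∫ s in (0 : ℝ)..t, x s.toNNReal) + l t) (t : ℝ≥0) :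
    x t = x₀ * Real.exp (-(lam * t)) + l t -
      ∫ s in (0 : ℝ)..t, lam * Real.exp (-(lam * (t - s))) * l s.toNNReal := by
  set y : ℝ → ℝ := fun u => ∫ s in (0 : ℝ)..u, x s.toNNReal with hy
  have hint : ∀ u : ℝ, 0 ≤ u → IntervalIntegrable (fun s : ℝ => x s.toNNReal) volume 0 u :=
    fun u hu => by simpa [Real.coe_toNNReal u hu] using (h u.toNNReal).1
  have heq : ∀ u : ℝ, 0 ≤ u → x u.toNNReal = x₀ - lam * y u + l u.toNNReal := fun u hu => by
    simpa [Real.coe_toNNReal u hu] using (h u.toNNReal).2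
  have hycont : ∀ T : ℝ, 0 ≤ T → ContinuousOn y (Icc 0 T) := fun T hT => by
    have := intervalIntegral.continuousOn_primitive_interval (μ := volume)
      (f := fun s : ℝ => x s.toNNReal) (a := 0) (b := T)
      (by rw [uIcc_of_le hT]; exact (intervalIntegrable_iff_integrableOn_Icc_of_le hT).1 (hint T hT))
    rwa [uIcc_of_le hT] at this
  have hxright : ∀ u : ℝ, 0 ≤ u →
      ContinuousWithinAt (fun s : ℝ => x s.toNNReal) (Ioi u) u := fun u hu => by
    have h1 : ContinuousWithinAt y (Ioi u) u := by
      refine ((hycont (u + 1) (by linarith)) u ⟨hu, by linarith⟩).mono_of_mem_nhdsWithin ?_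
      filter_upwards [Ioo_mem_nhdsGT (lt_add_one u)] with v hv using ⟨hu.trans hv.1.le, hv.2.le⟩
    have h2 := (hl.continuousWithinAt_toNNReal u).mono Ioi_subset_Ici_self
    refine ((continuousWithinAt_const.sub (continuousWithinAt_const.mul h1)).add h2).congr
      (fun v hv => heq v (hu.trans (le_of_lt hv))) (heq u hu)
  have hyderiv : ∀ u : ℝ, 0 ≤ u → HasDerivWithinAt y (x u.toNNReal) (Ioi u) u := fun u hu => by
    refine (intervalIntegral.integral_hasDerivWithinAt_right (s := Ici u) (hint u hu) ?_
      (hxright u hu)).mono Ioi_subset_Ici_self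
    refine ⟨Ioo u (u + 1), Ioo_mem_nhdsGT (lt_add_one u), ?_⟩
    have := (hint (u + 1) (by linarith)).aestronglyMeasurable
    have hsub : Ioo u (u + 1) ⊆ Ioc 0 (u + 1) := fun v hv => ⟨hu.trans_lt hv.1, hv.2.le⟩
    exact this.mono_measure (Measure.restrict_mono hsub le_rfl)
  have ht : (0 : ℝ) ≤ t := t.coe_nonneg
  have hexp : ∀ u : ℝ, HasDerivAt (fun u : ℝ => Real.exp (lam * u)) (lam * Real.exp (lam * u)) u :=
    fun u => by
      simpa [mul_comm] using ((hasDerivAt_id u).const_mul lam).exp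
  have hlint : IntervalIntegrable (fun s : ℝ => l s.toNNReal) volume 0 t := by
    have h1 : IntervalIntegrable (fun s : ℝ => x s.toNNReal - x₀ + lam * y s) volume 0 t := by
      refine ((hint t ht).sub intervalIntegrable_const).add (ContinuousOn.intervalIntegrable ?_)
      rw [uIcc_of_le ht]
      exact continuousOn_const.mul (hycont t ht)
    refine h1.congr fun s hs => ?_
    rw [uIoc_of_le ht] at hs
    simp only [heq s hs.1.le]
    ring
  have hlint' : IntervalIntegrable (fun s : ℝ => Real.exp (lam * s) * l s.toNNReal) volume 0 t :=
    hlint.continuousOn_mul (by fun_prop)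
  have hconst : ∫ s in (0 : ℝ)..t, x₀ * (lam * Real.exp (lam * s)) =
      x₀ * (Real.exp (lam * t) - 1) := by
    rw [intervalIntegral.integral_const_mul, intervalIntegral.integral_eq_sub_of_hasDerivAt
      (fun s _ => hexp s) (Continuous.intervalIntegrable (by fun_prop) _ _)]
    simp
  have hftc := intervalIntegral.integral_eq_sub_of_hasDeriv_right_of_le (a := 0) (b := t)
    (f := fun u => lam * (Real.exp (lam * u) * y u))
    (f' := fun s => x₀ * (lam * Real.exp (lam * s)) + lam * (Real.exp (lam * s) * l s.toNNReal)) ht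
    (continuousOn_const.mul ((Continuous.continuousOn (by fun_prop)).mul (hycont t ht)))
    (fun u hu => by
      have h1 := (((hexp u).hasDerivWithinAt (s := Ioi u)).mul (hyderiv u hu.1.le)).const_mul lam
      refine h1.congr_deriv ?_
      rw [heq u hu.1.le]
      ring)
    ((Continuous.intervalIntegrable (by fun_prop) _ _).add (hlint'.const_mul lam))
  rw [intervalIntegral.integral_add (Continuous.intervalIntegrable (by fun_prop) _ _)
    (hlint'.const_mul lam), hconst, intervalIntegral.integral_const_mul] at hftc
  have hy0 : y 0 = 0 := by simp [hy]
  rw [hy0] at hftc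
  have hfac : ∫ s in (0 : ℝ)..t, lam * Real.exp (-(lam * (t - s))) * l s.toNNReal =
      Real.exp (-(lam * t)) * (lam * ∫ s in (0 : ℝ)..t, Real.exp (lam * s) * l s.toNNReal) := by
    rw [← intervalIntegral.integral_const_mul, ← intervalIntegral.integral_const_mul]
    congr 1
    ext s
    rw [show -(lam * (t - s)) = -(lam * t) + lam * s by ring, Real.exp_add]
    ring
  have hinv : Real.exp (-(lam * t)) * Real.exp (lam * t) = 1 := by
    rw [← Real.exp_add]; simp
  rw [hfac, (h t).2]
  change x₀ - lam * y t + l t = _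
  linear_combination Real.exp (-(lam * t)) * hftc - (x₀ - lam * y t) * hinv

/-- The solution is a limit of weighted sums of increments of the driving path (summation by parts
in the Riemann sums of the variation of constants formula). -/
theorem tendsto_weighted_increments {x l : ℝ≥0 → ℝ} {lam x₀ : ℝ} (hl : IsCadlagPath l)
    (hl0 : l 0 = 0)
    (h : ∀ t : ℝ≥0, IntervalIntegrable (fun s : ℝ => x s.toNNReal) volume 0 t ∧
      x t = x₀ - lam * (∫ s in (0 : ℝ)..t, x s.toNNReal) + l t) (t : ℝ≥0) :
    Tendsto (fun N : ℕ => x₀ * Real.exp (-(lam * t)) + ∑ k ∈ Finset.range N,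
      Real.exp (-(lam * (t - k * (t / N)))) *
        (l (((k + 1 : ℕ) : ℝ≥0) * (t / N)) - l ((k : ℝ≥0) * (t / N)))) atTop (𝓝 (x t)) := by
  obtain ⟨C, hC⟩ := hl.exists_bound t
  have hR := tendsto_riemannSum_of_rightContinuous (f := fun s => l s.toNNReal)
    (G := fun s : ℝ => Real.exp (-(lam * (t - s))))
    (w := fun s => lam * Real.exp (-(lam * (t - s)))) (C := C) t.coe_nonneg
    (fun s _ => hl.continuousWithinAt_toNNReal s)
    (fun s hs => hC _ (Real.toNNReal_le_iff_le_coe.2 hs.2))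
    (fun s => by
      have h1 : HasDerivAt (fun s : ℝ => -(lam * (t - s))) lam s := by
        simpa using (((hasDerivAt_id s).const_sub (t : ℝ)).const_mul lam).fun_neg
      simpa [mul_comm] using h1.exp)
    (by fun_prop)
  rw [eq_of_integral_equation hl h t]
  refine (hR.const_sub (x₀ * Real.exp (-(lam * t)) + l t)).congr' ?_
  filter_upwards [eventually_ge_atTop 1] with N hN
  have hN' : (N : ℝ≥0) ≠ 0 := by positivity
  have hN'' : (N : ℝ) ≠ 0 := by positivity
  have htel := Finset.sum_range_sub (fun k : ℕ =>
    Real.exp (-(lam * (t - k * (t / N)))) * l ((k : ℝ≥0) * (t / N))) N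
  rw [mul_div_cancel₀ _ hN', mul_div_cancel₀ _ hN''] at htel
  simp only [sub_self, mul_zero, neg_zero, Real.exp_zero, one_mul, Nat.cast_zero, zero_mul,
    hl0, sub_zero] at htel
  rw [← htel, add_sub_assoc, ← Finset.sum_sub_distrib]
  congr 1
  refine Finset.sum_congr rfl fun k _ => ?_
  have : (((k : ℝ) + 1) * ((t : ℝ) / N)).toNNReal = ((k + 1 : ℕ) : ℝ≥0) * (t / N) := by
    rw [← Real.toNNReal_coe (r := ((k + 1 : ℕ) : ℝ≥0) * (t / N))]
    push_cast
    rfl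
  rw [this]
  push_cast
  ring

/-! ### The Gaussian law of the Ornstein-Uhlenbeck process -/

theorem eq_one_of_pow_eq_one {φ : ℝ → ℂ} (hφ : Continuous φ) (h0 : φ 0 = 1) {n : ℕ} (hn : 0 < n)
    (h : ∀ z, φ z ^ n = 1) (z : ℝ) : φ z = 1 := by
  classical
  have hfin : ((Polynomial.nthRoots n (1 : ℂ)).toFinset : Set ℂ).Finite := Finset.finite_toSet _
  rw [← h0]
  refine isPreconnected_univ.constant_of_mapsTo
    (T := ((Polynomial.nthRoots n (1 : ℂ)).toFinset : Set ℂ))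
    hfin.isDiscrete hφ.continuousOn (fun z _ => ?_)
    (mem_univ z) (mem_univ 0)
  simpa [Polynomial.mem_nthRoots hn] using h z

theorem tendsto_charFun_map_of_ae {Ω : Type*} [MeasurableSpace Ω] {P : Measure Ω}
    [IsProbabilityMeasure P] {Y : ℕ → Ω → ℝ} {Z : Ω → ℝ} (hY : ∀ n, Measurable (Y n))
    (hZ : Measurable Z) (h : ∀ᵐ ω ∂P, Tendsto (fun n => Y n ω) atTop (𝓝 (Z ω))) (z : ℝ) :
    Tendsto (fun n => charFun (P.map (Y n)) z) atTop (𝓝 (charFun (P.map Z) z)) := by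
  have hcf : ∀ W : Ω → ℝ, Measurable W →
      charFun (P.map W) z = ∫ ω, Complex.exp (z * W ω * Complex.I) ∂P := fun W hW => by
    rw [charFun_apply_real, integral_map hW.aemeasurable (by fun_prop)]
  rw [hcf Z hZ]
  simp_rw [fun n => hcf (Y n) (hY n)]
  refine tendsto_integral_of_dominated_convergence (fun _ => 1) (fun n => ?_)
    (integrable_const 1) (fun n => ae_of_all _ fun ω => ?_) ?_
  · have := hY n
    exact Measurable.aestronglyMeasurable (by fun_prop)
  · rw [← Complex.ofReal_mul, Complex.norm_exp_ofReal_mul_I]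
  · filter_upwards [h] with ω hω
    have h1 : Continuous fun x : ℝ => Complex.exp (z * x * Complex.I) := by fun_prop
    exact (h1.tendsto _).comp hω

section Levy

variable {Ω : Type*} [MeasurableSpace Ω] {P : Measure Ω} {L X : ℝ≥0 → Ω → ℝ}

theorem IsLevyProcess.charFun_weighted_increments (hL : IsLevyProcess L P) (h : ℝ≥0) (a : ℕ → ℝ)
    (N : ℕ) (z : ℝ) :
    charFun (P.map fun ω => ∑ k ∈ Finset.range N,
      a k * (L (((k + 1 : ℕ) : ℝ≥0) * h) ω - L ((k : ℝ≥0) * h) ω)) z =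
      ∏ k ∈ Finset.range N, charFun (P.map (L h)) (a k * z) := by
  have hmono : Monotone fun k : ℕ => (k : ℝ≥0) * h := fun k m hkm => by dsimp only; gcongr
  have hind := (hL.indep.nat hmono).comp (fun k y => a k * y) fun k => by fun_prop
  have hmeas : ∀ k : ℕ, Measurable fun ω => L (((k + 1 : ℕ) : ℝ≥0) * h) ω - L ((k : ℝ≥0) * h) ω :=
    fun k => (hL.measurable _).sub (hL.measurable _)
  have hprod := iIndepFun.charFun_map_fun_finsetSum_eq_prod (s := Finset.range N)
    (X := fun k ω => a k * (L (((k + 1 : ℕ) : ℝ≥0) * h) ω - L ((k : ℝ≥0) * h) ω)) (P := P)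
    (fun k _ => ((hmeas k).const_mul _).aemeasurable)
    (hind.precomp (g := ((↑) : Finset.range N → ℕ)) Subtype.val_injective)
  rw [hprod, Finset.prod_apply]
  refine Finset.prod_congr rfl fun k _ => ?_
  rw [charFun_map_mul_comp (hmeas k).aemeasurable, ← hL.stationary ((k : ℝ≥0) * h) h]
  congr 5
  ext ω
  push_cast
  rw [add_mul, one_mul]

theorem IsLevyProcess.charFun_nat_mul [IsProbabilityMeasure P] (hL : IsLevyProcess L P)
    (h : ℝ≥0) (N : ℕ) (z : ℝ) :
    charFun (P.map (L (N * h))) z = charFun (P.map (L h)) z ^ N := by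
  have h1 := hL.charFun_weighted_increments h (fun _ => 1) N z
  simp only [one_mul, Finset.prod_const, Finset.card_range] at h1
  rw [← h1]
  congr 1
  refine Measure.map_congr ?_
  filter_upwards [hL.zero] with ω hω
  rw [Finset.sum_range_sub (fun k : ℕ => L ((k : ℝ≥0) * h) ω)]
  simp [hω]

/-- The one-dimensional laws of the driving Lévy process. For `t = 1 / n` the characteristic function
is a continuous `n`-th root of `exp (-c z ^ 2)` with value `1` at `0`, which determines it; rational
times follow by independence and real times by right-continuity. -/
theorem IsStableLevyProcess.charFun_eq [IsProbabilityMeasure P] {c : ℝ}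
    (hL : IsStableLevyProcess 2 c L P) (t : ℝ≥0) (z : ℝ) :
    charFun (P.map (L t)) z = Complex.exp ((-(c * t * z ^ 2) : ℝ) : ℂ) := by
  have hone : ∀ z : ℝ, charFun (P.map (L 1)) z = Complex.exp ((-(c * z ^ 2) : ℝ) : ℂ) := fun z => by
    rw [hL.charFun_one z]
    norm_num
  have hprob : ∀ s, IsProbabilityMeasure (P.map (L s)) := fun s =>
    Measure.isProbabilityMeasure_map (hL.measurable s).aemeasurable
  have hinv : ∀ n : ℕ, 0 < n → ∀ z : ℝ, charFun (P.map (L (1 / n))) z =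
      Complex.exp ((-(c * z ^ 2 / n) : ℝ) : ℂ) := by
    intro n hn z
    have hn' : (n : ℂ) ≠ 0 := by exact_mod_cast hn.ne'
    have hn'' : (n : ℝ≥0) ≠ 0 := by exact_mod_cast hn.ne'
    have h1 := eq_one_of_pow_eq_one
      (φ := fun z => charFun (P.map (L (1 / n))) z * Complex.exp ((c * z ^ 2 / n : ℝ) : ℂ))
      (continuous_charFun.mul (by fun_prop)) (by simp) hn (fun z => by
        rw [mul_pow, ← hL.charFun_nat_mul, mul_one_div_cancel hn'', hone, ← Complex.exp_nat_mul,
          ← Complex.exp_add]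
        push_cast
        rw [mul_div_cancel₀ _ hn']
        simp) z
    rw [Complex.ofReal_neg, Complex.exp_neg]
    exact eq_inv_of_mul_eq_one_left h1
  -- approximate `t` from the right by rationals
  set q : ℕ → ℝ≥0 := fun n => (⌈t * n⌉₊ : ℝ≥0) * (1 / n) with hq
  have hqt : Tendsto q atTop (𝓝 t) := by
    have := (tendsto_nat_ceil_mul_div_atTop (R := ℝ) t.coe_nonneg).comp
      tendsto_natCast_atTop_atTop
    rw [← NNReal.tendsto_coe]
    refine this.congr fun n => ?_
    simp only [Function.comp, hq, NNReal.coe_natCast, NNReal.coe_div, mul_one_div]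
    congr 2
  have hqle : ∀ᶠ n in atTop, t ≤ q n := by
    filter_upwards [eventually_gt_atTop 0] with n hn
    have hn' : (0 : ℝ≥0) < n := by exact_mod_cast hn
    simp only [hq]
    rw [mul_one_div, le_div_iff₀ hn']
    exact Nat.le_ceil _
  have hlim : Tendsto (fun n => charFun (P.map (L (q n))) z) atTop
      (𝓝 (charFun (P.map (L t)) z)) := by
    refine tendsto_charFun_map_of_ae (fun n => hL.measurable _) (hL.measurable t) ?_ z
    filter_upwards [hL.cadlag] with ω hω
    exact (hω t).1.tendsto.comp (tendsto_nhdsWithin_iff.2 ⟨hqt, hqle⟩)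
  refine tendsto_nhds_unique hlim ?_
  have h2 : Tendsto (fun n => Complex.exp ((-(c * (q n) * z ^ 2) : ℝ) : ℂ)) atTop
      (𝓝 (Complex.exp ((-(c * t * z ^ 2) : ℝ) : ℂ))) := by
    have h3 : Continuous fun s : ℝ => Complex.exp ((-(c * s * z ^ 2) : ℝ) : ℂ) := by fun_prop
    exact (h3.tendsto _).comp (NNReal.tendsto_coe.2 hqt)
  refine h2.congr' ?_
  filter_upwards [eventually_gt_atTop 0] with n hn
  rw [hL.charFun_nat_mul, hinv n hn, ← Complex.exp_nat_mul]
  congr 1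
  rw [hq]
  push_cast
  ring

/-- The variances of the weighted sums of increments in `tendsto_weighted_increments`, divided by
`2 c`, converge. The weights are taken at left endpoints, which costs a factor
`exp (-2 lam t / N)` compared with `tendsto_riemannSum_of_rightContinuous`. -/
theorem tendsto_sum_sq_weights {lam : ℝ} (hlam : 0 < lam) (t : ℝ≥0) :
    Tendsto (fun N : ℕ => ∑ k ∈ Finset.range N,
      (t / N : ℝ) * Real.exp (-(lam * (t - k * (t / N)))) ^ 2) atTop
      (𝓝 ((1 - Real.exp (-(lam * t)) ^ 2) / (2 * lam))) := by
  have hexp : ∀ s : ℝ, HasDerivAt (fun s : ℝ => Real.exp (-(2 * lam * (t - s))) / (2 * lam))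
      (Real.exp (-(2 * lam * (t - s)))) s := fun s => by
    have h1 : HasDerivAt (fun s : ℝ => -(2 * lam * (t - s))) (2 * lam) s := by
      simpa using (((hasDerivAt_id s).const_sub (t : ℝ)).const_mul (2 * lam)).fun_neg
    have h2 := h1.exp.div_const (2 * lam)
    rwa [mul_div_cancel_right₀ _ (by positivity)] at h2
  have hR := tendsto_riemannSum_of_rightContinuous
    (f := fun s : ℝ => Real.exp (-(2 * lam * (t - s)))) (G := id) (w := fun _ => 1) (C := 1)
    t.coe_nonneg (fun s _ => Continuous.continuousWithinAt (by fun_prop))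
    (fun s hs => by
      rw [abs_of_pos (Real.exp_pos _), Real.exp_le_one_iff, neg_nonpos]
      exact mul_nonneg (by positivity) (sub_nonneg.2 hs.2))
    (fun s => hasDerivAt_id s) continuous_const
  have hint : ∫ s in (0 : ℝ)..t, 1 * Real.exp (-(2 * lam * (t - s))) =
      (1 - Real.exp (-(lam * t)) ^ 2) / (2 * lam) := by
    simp only [one_mul]
    rw [intervalIntegral.integral_eq_sub_of_hasDerivAt (fun s _ => hexp s)
      (Continuous.intervalIntegrable (by fun_prop) _ _), ← Real.exp_nat_mul, sub_self, mul_zero,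
      neg_zero, Real.exp_zero, ← sub_div]
    congr 3
    push_cast
    ring
  have hcorr : Tendsto (fun N : ℕ => Real.exp (-(2 * lam * (t / N)))) atTop (𝓝 1) := by
    have h1 : Continuous fun y : ℝ => Real.exp (-(2 * lam * y)) := by fun_prop
    have h2 := (h1.tendsto 0).comp (tendsto_const_div_atTop_nhds_zero_nat (t : ℝ))
    simpa [Function.comp_def] using h2
  rw [hint] at hR
  have h3 := hcorr.mul hR
  rw [one_mul] at h3
  refine h3.congr fun N => ?_
  rw [Finset.mul_sum]
  refine Finset.sum_congr rfl fun k _ => ?_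
  rw [id, id, mul_left_comm, ← Real.exp_add, ← Real.exp_nat_mul]
  congr 1
  · ring
  · congr 1
    push_cast
    ring

/-- The Ornstein-Uhlenbeck process with Gaussian noise is Gaussian at each time, with mean
`x₀ exp (-lam t)` and variance `(c / lam) (1 - exp (-2 lam t))`. -/
theorem IsOUProcess.map_eq_gaussianReal [IsProbabilityMeasure P] {lam c x₀ : ℝ}
    (hlam : 0 < lam) (hc : 0 < c) (hX : IsOUProcess lam 2 c x₀ X P) (t : ℝ≥0) :
    P.map (X t) = gaussianReal (x₀ * Real.exp (-(lam * t)))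
      (Real.toNNReal (c / lam * (1 - Real.exp (-(lam * t)) ^ 2))) := by
  obtain ⟨L, hL, hXL⟩ := hX
  have := Measure.isProbabilityMeasure_map (μ := P) (hXL.measurable t).aemeasurable
  refine Measure.ext_of_charFun (funext fun z => ?_)
  set m := x₀ * Real.exp (-(lam * t)) with hm
  set a : ℕ → ℕ → ℝ := fun N k => Real.exp (-(lam * (t - k * (t / N)))) with ha
  set S : ℕ → Ω → ℝ := fun N ω => ∑ k ∈ Finset.range N, a N k *
    (L (((k + 1 : ℕ) : ℝ≥0) * (t / N)) ω - L ((k : ℝ≥0) * (t / N)) ω) with hS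
  have hSm : ∀ N, Measurable (S N) := fun N =>
    Finset.measurable_fun_sum _ fun k _ =>
      ((hL.measurable _).sub (hL.measurable _)).const_mul _
  have hlim := tendsto_charFun_map_of_ae (P := P) (Y := fun N ω => m + S N ω) (Z := X t)
    (fun N => (hSm N).const_add m) (hXL.measurable t) (by
      filter_upwards [hL.cadlag, hL.zero, hXL.equation] with ω h1 h2 h3
      exact tendsto_weighted_increments (x := fun s => X s ω) h1 h2 h3 t) z
  have hcf : ∀ N : ℕ, charFun (P.map fun ω => m + S N ω) z =
      Complex.exp (-((c * z ^ 2 * ∑ k ∈ Finset.range N, (t / N : ℝ) * a N k ^ 2 : ℝ) : ℂ) +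
        m * z * Complex.I) := by
    intro N
    have h1 : (P.map fun ω => m + S N ω) = (P.map (S N)).map (m + ·) := by
      rw [Measure.map_map (by fun_prop) (hSm N)]
      rfl
    rw [h1, charFun_map_const_add, hS, hL.charFun_weighted_increments, Complex.exp_add]
    simp_rw [hL.charFun_eq]
    rw [← Complex.exp_sum]
    congr 2
    · rw [Finset.mul_sum]
      push_cast
      rw [← Finset.sum_neg_distrib]
      refine Finset.sum_congr rfl fun k _ => ?_
      ring
    · simp [mul_comm]
  have hlim' : Tendsto (fun N : ℕ => charFun (P.map fun ω => m + S N ω) z) atTop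
      (𝓝 (Complex.exp (-((c * z ^ 2 * ((1 - Real.exp (-(lam * t)) ^ 2) / (2 * lam)) : ℝ) : ℂ) +
        m * z * Complex.I))) := by
    simp_rw [hcf]
    have h1 : Continuous fun y : ℝ =>
        Complex.exp (-((c * z ^ 2 * y : ℝ) : ℂ) + m * z * Complex.I) := by fun_prop
    exact (h1.tendsto _).comp (tendsto_sum_sq_weights hlam t)
  rw [tendsto_nhds_unique hlim hlim', charFun_gaussianReal]
  have hv : 0 ≤ c / lam * (1 - Real.exp (-(lam * t)) ^ 2) := by
    refine mul_nonneg (by positivity) (sub_nonneg.2 (pow_le_one₀ (Real.exp_pos _).le ?_))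
    exact Real.exp_le_one_iff.2 (neg_nonpos.2 (by positivity))
  have hcast : ((Real.toNNReal (c / lam * (1 - Real.exp (-(lam * t)) ^ 2)) : ℝ≥0) : ℂ) =
      ((c / lam * (1 - Real.exp (-(lam * t)) ^ 2) : ℝ) : ℂ) := by
    rw [← Complex.ofReal_inj.2 (Real.coe_toNNReal _ hv)]
  rw [hcast]
  congr 1
  have hlam' : (lam : ℂ) ≠ 0 := by exact_mod_cast hlam.ne'
  push_cast
  field_simp
  ring

end Levy

theorem IsOUProcess.tendstoInDistribution {Ω : Type*} [MeasurableSpace Ω] {P : Measure Ω}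
    [IsProbabilityMeasure P] {lam c x₀ : ℝ} (hlam : 0 < lam) (hc : 0 < c) {X : ℝ≥0 → Ω → ℝ}
    (hX : IsOUProcess lam 2 c x₀ X P) :
    TendstoInDistribution X atTop (id : ℝ → ℝ) (fun _ => P)
      (gaussianReal 0 (Real.toNNReal (c / lam))) where
  forall_aemeasurable t := hX.choose_spec.2.measurable t |>.aemeasurable
  aemeasurable_limit := aemeasurable_id
  tendsto := by
    refine tendsto_of_seq_tendsto fun u hu => ?_
    refine ProbabilityMeasure.tendsto_of_tendsto_charFun fun z => ?_
    have hexp : Tendsto (fun n => Real.exp (-(lam * (u n : ℝ)))) atTop (𝓝 0) :=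
      Real.tendsto_exp_neg_atTop_nhds_zero.comp
        ((NNReal.tendsto_coe_atTop.2 hu).const_mul_atTop hlam)
    have h1 : Continuous fun y : ℝ => Complex.exp (z * ((x₀ * y : ℝ) : ℂ) * Complex.I -
        (((Real.toNNReal (c / lam * (1 - y ^ 2)) : ℝ≥0) : ℝ) : ℂ) * z ^ 2 / 2) := by fun_prop
    have h2 := (h1.tendsto 0).comp hexp
    have h3 : Tendsto (fun n => charFun (P.map (X (u n))) z) atTop
        (𝓝 (charFun ((gaussianReal 0 (Real.toNNReal (c / lam))).map id) z)) := by
      simp only [Measure.map_id, hX.map_eq_gaussianReal hlam hc, charFun_gaussianReal]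
      simpa [Function.comp_def] using h2
    exact h3

/-! ### Distance to equilibrium of the maximum -/

theorem iidMaxLaw_congr {n : ℕ} {ν ν' : Measure ℝ} [SigmaFinite ν] [SigmaFinite ν'] (h : ν = ν') :
    iidMaxLaw n ν = iidMaxLaw n ν' := by
  subst h
  rfl

theorem gaussianReal_eq_map_affine (m s : ℝ) :
    gaussianReal m (Real.toNNReal (s ^ 2)) = (gaussianReal 0 1).map fun y => m + s * y := by
  have h1 : (fun y : ℝ => m + s * y) = (m + ·) ∘ (s * ·) := rfl
  rw [h1, ← Measure.map_map (by fun_prop) (by fun_prop), gaussianReal_map_const_mul,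
    gaussianReal_map_const_add, mul_zero, zero_add, mul_one,
    ← Real.toNNReal_of_nonneg (sq_nonneg s)]

theorem maxLaw_eq_iidMaxLaw {Ω : Type*} [MeasurableSpace Ω] {P : Measure Ω} [IsProbabilityMeasure P]
    {n : ℕ} {X : Fin n → ℝ≥0 → Ω → ℝ} {t : ℝ≥0} {ν : Measure ℝ} [IsProbabilityMeasure ν]
    (hm : ∀ j, Measurable (X j t)) (hindep : iIndepFun (fun j ω => X j t ω) P)
    (hlaw : ∀ j, P.map (X j t) = ν) : maxLaw X P t = iidMaxLaw n ν := by
  have h1 := (iIndepFun_iff_map_fun_eq_pi_map fun j => (hm j).aemeasurable).1 hindep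
  have h2 : (fun j => P.map fun ω => X j t ω) = fun _ : Fin n => ν := funext hlaw
  simp only [h2] at h1
  rw [iidMaxLaw, ← h1, Measure.map_map (measurable_vecMax n) (measurable_pi_lambda _ hm)]
  rfl

/-- The distance to equilibrium of the maximum of `n` Ornstein-Uhlenbeck processes in terms of
`δ = exp (-lam t)`, where `q` is the starting point divided by the stationary standard deviation;
see `tvDist_iidMaxLaw_gaussianReal`. -/
noncomputable def maxDist (q : ℝ) (n : ℕ) (δ : ℝ) : ℝ :=
  tvDist ((iidMaxLaw n (gaussianReal 0 1)).map fun y => q * δ + √(1 - δ ^ 2) * y)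
    (iidMaxLaw n (gaussianReal 0 1))

theorem tvDist_iidMaxLaw_gaussianReal {n : ℕ} (hn : 1 ≤ n) {v x₀ δ : ℝ} (hv : 0 < v)
    (hδ : δ ^ 2 < 1) :
    tvDist (iidMaxLaw n (gaussianReal (x₀ * δ) (Real.toNNReal (v * (1 - δ ^ 2)))))
      (iidMaxLaw n (gaussianReal 0 (Real.toNNReal v))) = maxDist (x₀ / √v) n δ := by
  set σ := √v with hσ
  have hσ0 : 0 < σ := Real.sqrt_pos.2 hv
  set s := √(1 - δ ^ 2) with hs
  have hs0 : 0 < s := Real.sqrt_pos.2 (sub_pos.2 hδ)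
  have hv1 : v * (1 - δ ^ 2) = (σ * s) ^ 2 := by
    rw [mul_pow, Real.sq_sqrt hv.le, Real.sq_sqrt (sub_pos.2 hδ).le]
  have hv2 : v = σ ^ 2 := (Real.sq_sqrt hv.le).symm
  have hm (a b : ℝ) : Measurable fun y : ℝ => a + b * y := by fun_prop
  have hp (ρ : Measure ℝ) [IsProbabilityMeasure ρ] (a b : ℝ) :
      IsProbabilityMeasure (ρ.map fun y => a + b * y) :=
    Measure.isProbabilityMeasure_map (hm a b).aemeasurable
  have e1 := gaussianReal_eq_map_affine (x₀ * δ) (σ * s)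
  have e2 := gaussianReal_eq_map_affine 0 σ
  rw [← hv1] at e1
  rw [← hv2] at e2
  have := hp (gaussianReal 0 1) (x₀ * δ) (σ * s)
  have := hp (gaussianReal 0 1) 0 σ
  rw [iidMaxLaw_congr e1, iidMaxLaw_congr e2, iidMaxLaw_map_affine hn _ _ (mul_pos hσ0 hs0),
    iidMaxLaw_map_affine hn _ _ hσ0, maxDist]
  have := hp (iidMaxLaw n (gaussianReal 0 1)) (x₀ / σ * δ) s
  rw [← tvDist_map_of_leftInverse ((iidMaxLaw n (gaussianReal 0 1)).map fun y => x₀ / σ * δ + s * y)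
    (iidMaxLaw n (gaussianReal 0 1)) (hm 0 σ) (measurable_id.div_const σ)
    (fun y => by simp [hσ0.ne']), Measure.map_map (hm 0 σ) (hm _ _)]
  congr 2
  ext y
  simp only [Function.comp]
  field_simp
  ring

theorem tendsto_sqrt_one_sub_sq {ι : Type*} {l : Filter ι} {δ : ι → ℝ}
    (hδ : Tendsto δ l (𝓝 0)) : Tendsto (fun i => √(1 - δ i ^ 2)) l (𝓝 1) := by
  have h1 : Continuous fun y : ℝ => √(1 - y ^ 2) := by fun_prop
  simpa [Function.comp_def] using (h1.tendsto 0).comp hδ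

theorem tendsto_maxDist_zero {ι : Type*} {l : Filter ι} [l.IsCountablyGenerated] (q : ℝ) {n : ℕ}
    (hn : 1 ≤ n) {δ : ι → ℝ} (hδ : Tendsto δ l (𝓝 0)) :
    Tendsto (fun i => maxDist q n (δ i)) l (𝓝 0) := by
  have hd := hasCDFDeriv_gaussianReal.iidMaxLaw hn
  have hcont : Continuous fun x : ℝ =>
      n * cdf (gaussianReal 0 1) x ^ (n - 1) * gaussianPDFReal 0 1 x := by
    have h1 : Continuous (cdf (gaussianReal 0 1)) :=
      continuous_iff_continuousAt.2 fun x => (hasCDFDeriv_gaussianReal x).continuousAt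
    have h2 : Continuous (gaussianPDFReal 0 1) := by unfold gaussianPDFReal; fun_prop
    fun_prop
  have hA : Tendsto (fun i => q * δ i) l (𝓝 0) := by simpa using hδ.const_mul q
  have := tendsto_tvDist_map_affine (l := l) (μ := fun _ => iidMaxLaw n (gaussianReal 0 1))
    (Eventually.of_forall fun _ => hd) hd (fun u x hu => (hcont.tendsto x).comp hu) hA
    (tendsto_sqrt_one_sub_sq hδ)
  simpa only [zero_add, Measure.map_id', maxDist] using this

theorem maxDist_eq_normalized (q : ℝ) {n : ℕ} (hr : 0 < maxRate n) (δ : ℝ) :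
    maxDist q n δ = tvDist ((normalizedMaxLaw n).map fun y =>
      (q * (maxRate n * δ) + (1 - √(1 - δ ^ 2)) * (maxCorr n - maxRate n ^ 2)) +
        √(1 - δ ^ 2) * y) (normalizedMaxLaw n) := by
  have hm (a b : ℝ) : Measurable fun y : ℝ => a + b * y := by fun_prop
  have := Measure.isProbabilityMeasure_map (μ := iidMaxLaw n (gaussianReal 0 1))
    (hm (q * δ) √(1 - δ ^ 2)).aemeasurable
  have hinv : Function.LeftInverse
      (fun y => (y - (maxCorr n - maxRate n ^ 2)) / maxRate n)
      (fun y => (maxCorr n - maxRate n ^ 2) + maxRate n * y) := fun y => by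
    simp [hr.ne']
  rw [maxDist, ← tvDist_map_of_leftInverse ((iidMaxLaw n (gaussianReal 0 1)).map _) _
    (hm (maxCorr n - maxRate n ^ 2) (maxRate n)) (by fun_prop) hinv,
    Measure.map_map (hm _ _) (hm _ _), normalizedMaxLaw, Measure.map_map (hm _ _) (hm _ _)]
  congr 2
  ext y
  simp only [Function.comp]
  ring

theorem tendsto_maxDist_gumbel (q : ℝ) {δ : ℕ → ℝ} {ρ : ℝ}
    (hδ : Tendsto (fun n => maxRate n * δ n) atTop (𝓝 ρ)) :
    Tendsto (fun n => maxDist q n (δ n)) atTop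
      (𝓝 (tvDist (gumbel.map fun y => (q * ρ - ρ ^ 2 / 2) + y) gumbel)) := by
  have hpos := tendsto_maxRate.eventually_gt_atTop 0
  have hδ0 : Tendsto δ atTop (𝓝 0) := by
    refine (hδ.div_atTop tendsto_maxRate).congr' ?_
    filter_upwards [hpos] with n hn
    rw [mul_div_cancel_left₀ _ hn.ne']
  have hs := tendsto_sqrt_one_sub_sq hδ0
  set s : ℕ → ℝ := fun n => √(1 - δ n ^ 2) with hs_def
  set A : ℕ → ℝ := fun n =>
    q * (maxRate n * δ n) + (1 - s n) * (maxCorr n - maxRate n ^ 2) with hA_def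
  -- `1 - s = δ ^ 2 / (1 + s)`, so the shift is governed by `(r δ) ^ 2`
  have hA : Tendsto A atTop (𝓝 (q * ρ - ρ ^ 2 / 2)) := by
    have h1 : Tendsto (fun n => maxCorr n / maxRate n / maxRate n - 1) atTop (𝓝 (-1)) := by
      simpa using (tendsto_maxCorr_div.div_atTop tendsto_maxRate).sub_const 1
    have h2 : Tendsto (fun n => q * (maxRate n * δ n) + (maxRate n * δ n) ^ 2 / (1 + s n) *
        (maxCorr n / maxRate n / maxRate n - 1)) atTop
        (𝓝 (q * ρ + ρ ^ 2 / (1 + 1) * (-1))) :=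
      (hδ.const_mul q).add (((hδ.pow 2).div (hs.const_add 1) (by norm_num)).mul h1)
    rw [show q * ρ + ρ ^ 2 / (1 + 1) * (-1) = q * ρ - ρ ^ 2 / 2 by ring] at h2
    refine h2.congr' ?_
    filter_upwards [hpos, hδ0.eventually (Ioo_mem_nhds (neg_lt_zero.2 one_pos) one_pos)]
      with n hn hδn
    have hsq : s n ^ 2 = 1 - δ n ^ 2 :=
      Real.sq_sqrt (by nlinarith [hδn.1, hδn.2])
    have hsn : 0 ≤ s n := Real.sqrt_nonneg _
    rw [hA_def]
    dsimp only
    congr 1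
    have h3 : (1 - s n) = δ n ^ 2 / (1 + s n) := by
      rw [eq_div_iff (by positivity)]
      linear_combination -hsq
    rw [h3]
    field_simp
  have hcont : ∀ᶠ n in atTop, HasCDFDeriv (normalizedMaxLaw n) (normalizedMaxDensity n) := by
    filter_upwards [hpos, eventually_ge_atTop 1] with n hr hn
      using hasCDFDeriv_normalizedMaxLaw hn hr
  have hm (a b : ℝ) : Measurable fun y : ℝ => a + b * y := by fun_prop
  have := fun n => Measure.isProbabilityMeasure_map (μ := normalizedMaxLaw n)
    (hm (A n) (s n)).aemeasurable
  have := Measure.isProbabilityMeasure_map (μ := gumbel) (f := fun y => (q * ρ - ρ ^ 2 / 2) + y)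
    (by fun_prop)
  have key1 := tendsto_tvDist_map_affine hcont hasCDFDeriv_gumbel tendsto_normalizedMaxDensity hA hs
  have key2 := tendsto_tvDist_zero_of_tendsto_density hcont hasCDFDeriv_gumbel
    (fun x => tendsto_normalizedMaxDensity (fun _ => x) x tendsto_const_nhds)
  refine (tendsto_tvDist_of_tendsto_zero _ _ _ _ key1 key2).congr' ?_
  filter_upwards [hpos] with n hn
  rw [maxDist_eq_normalized q hn]

/-! ### The profile function and the cut-off time -/

theorem tendsto_tvDist_gumbel_add_zero {l : Filter ℝ} [l.IsCountablyGenerated] {a : ℝ → ℝ}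
    (ha : Tendsto a l (𝓝 0)) :
    Tendsto (fun b => tvDist (gumbel.map fun y => a b + y) gumbel) l (𝓝 0) := by
  have hcont : Continuous fun x : ℝ => Real.exp (-x) * Real.exp (-Real.exp (-x)) := by fun_prop
  have := tendsto_tvDist_map_affine (l := l) (μ := fun _ => gumbel)
    (Eventually.of_forall fun _ => hasCDFDeriv_gumbel) hasCDFDeriv_gumbel
    (fun u x hu => (hcont.tendsto x).comp hu) ha (tendsto_const_nhds (x := (1 : ℝ)))
  simpa only [zero_add, Measure.map_id', one_mul] using this

theorem tendsto_tvDist_gumbel_add_one {l : Filter ℝ} {a : ℝ → ℝ} (ha : Tendsto a l atBot) :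
    Tendsto (fun b => tvDist (gumbel.map fun y => a b + y) gumbel) l (𝓝 1) := by
  have hm (a : ℝ) : Measurable fun y : ℝ => a + y := by fun_prop
  have hp (a : ℝ) : IsProbabilityMeasure (gumbel.map fun y => a + y) :=
    Measure.isProbabilityMeasure_map (hm a).aemeasurable
  have hcdf (x : ℝ) : gumbel.real (Iic x) = gumbelCDF x := by
    rw [measureReal_def, gumbel_Iic, ENNReal.toReal_ofReal (Real.exp_pos _).le]
    rfl
  -- half-way between the two laws, the half-line `(-∞, a / 2]` separates them
  have hlow : Tendsto (fun b => gumbelCDF (-(a b / 2)) - gumbelCDF (a b / 2)) l (𝓝 1) := by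
    have h1 : Tendsto (fun b => a b / 2) l atBot := ha.atBot_div_const two_pos
    simpa using (tendsto_gumbelCDF_atTop.comp (tendsto_neg_atBot_atTop.comp h1)).sub
      (tendsto_gumbelCDF_atBot.comp h1)
  refine tendsto_of_tendsto_of_tendsto_of_le_of_le hlow tendsto_const_nhds (fun b => ?_)
    fun b => tvDist_le_one _ _
  have h1 := abs_measureReal_sub_le_tvDist (gumbel.map fun y => a b + y) gumbel
    (measurableSet_Iic (a := a b / 2))
  have h2 : (fun y => a b + y) ⁻¹' Iic (a b / 2) = Iic (-(a b / 2)) := by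
    ext y
    simp only [mem_preimage, mem_Iic]
    constructor <;> intro h <;> linarith
  rw [map_measureReal_apply (hm _) measurableSet_Iic, h2, hcdf, hcdf] at h1
  exact (le_abs_self _).trans h1

theorem tendsto_gumbelProfile_atTop {lam c x₀ κ : ℝ} (hlam : 0 < lam) (hκ : 0 < κ) :
    Tendsto (gumbelProfile lam c x₀ κ) atTop (𝓝 0) := by
  refine tendsto_tvDist_gumbel_add_zero ?_
  have h (r : ℝ) (hr : 0 < r) : Tendsto (fun b : ℝ => Real.exp (-(r * b))) atTop (𝓝 0) :=
    Real.tendsto_exp_neg_atTop_nhds_zero.comp (tendsto_id.const_mul_atTop hr)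
  simpa using (((h (lam * κ) (by positivity)).const_mul (√(2 * lam / c))).mul_const x₀).sub
    (h (2 * lam * κ) (by positivity))

theorem tendsto_gumbelProfile_atBot {lam c x₀ κ : ℝ} (hlam : 0 < lam) (hκ : 0 < κ) :
    Tendsto (gumbelProfile lam c x₀ κ) atBot (𝓝 1) := by
  refine tendsto_tvDist_gumbel_add_one ?_
  have h : Tendsto (fun b : ℝ => Real.exp (-(lam * κ * b))) atBot atTop :=
    Real.tendsto_exp_atTop.comp
      (tendsto_neg_atBot_atTop.comp (tendsto_id.const_mul_atBot (by positivity)))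
  -- with `y = exp (-lam κ b)` the shift is `y (√(2 lam / c) x₀ - y)`
  have h2 : Tendsto (fun b : ℝ => √(2 * lam / c) * x₀ - Real.exp (-(lam * κ * b))) atBot atBot :=
    tendsto_atBot_add_const_left _ _ (tendsto_neg_atTop_atBot.comp h)
  refine (h.atTop_mul_atBot₀ h2).congr fun b => ?_
  rw [show -(2 * lam * κ * b) = -(lam * κ * b) + -(lam * κ * b) by ring, Real.exp_add]
  ring

theorem tendsto_log_log_nat : Tendsto (fun n : ℕ => Real.log (Real.log n)) atTop atTop :=
  Real.tendsto_log_atTop.comp (Real.tendsto_log_atTop.comp tendsto_natCast_atTop_atTop)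

theorem tendsto_cutoffTime {lam : ℝ} (hlam : 0 < lam) :
    Tendsto (fun n : ℕ => 1 / (2 * lam) * Real.log (Real.log n)) atTop atTop :=
  tendsto_log_log_nat.const_mul_atTop (by positivity)

/-- At the cut-off times, `exp (-lam t)` is of the order of `1 / √(2 log n)`. -/
theorem tendsto_maxRate_mul_exp {lam κ b : ℝ} (hlam : 0 < lam) {o : ℕ → ℝ}
    (ho : Tendsto o atTop (𝓝 0)) :
    Tendsto (fun n : ℕ => maxRate n * Real.exp (-(lam *
      (1 / (2 * lam) * Real.log (Real.log n) + b * (κ + o n))))) atTop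
      (𝓝 (√2 * Real.exp (-(lam * κ * b)))) := by
  have h1 : Continuous fun y : ℝ => √2 * Real.exp (-(lam * (b * (κ + y)))) := by fun_prop
  have h2 := (h1.tendsto 0).comp ho
  rw [add_zero, show lam * (b * κ) = lam * κ * b by ring] at h2
  refine h2.congr' ?_
  filter_upwards [(Real.tendsto_log_atTop.comp tendsto_natCast_atTop_atTop).eventually_gt_atTop 0]
    with n hn
  simp only [Function.comp] at hn ⊢
  have h3 : Real.exp (-(1 / 2 * Real.log (Real.log n))) = (√(Real.log n))⁻¹ := by
    rw [Real.exp_neg, one_div_mul_eq_div, Real.exp_half, Real.exp_log hn]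
  rw [show -(lam * (1 / (2 * lam) * Real.log (Real.log n) + b * (κ + o n))) =
    -(1 / 2 * Real.log (Real.log n)) + -(lam * (b * (κ + o n))) by field_simp; ring,
    Real.exp_add, h3, maxRate, Real.sqrt_mul zero_le_two]
  have : √(Real.log n) ≠ 0 := (Real.sqrt_pos.2 hn).ne'
  field_simp

theorem theorem1 {Ω : ℕ → Type*} [∀ n, MeasurableSpace (Ω n)]
    (P : ∀ n, Measure (Ω n)) [∀ n, IsProbabilityMeasure (P n)]
    (lam c x₀ : ℝ) (hlam : 0 < lam) (hc : 0 < c)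
    -- for every `n`, independent Ornstein-Uhlenbeck processes `X n j`, `j : Fin n`, with `α = 2`
    (X : ∀ n, Fin n → ℝ≥0 → Ω n → ℝ)
    (hX : ∀ n j, IsOUProcess lam 2 c x₀ (X n j) (P n))
    (hindep : ∀ n, iIndepFun (fun (j : Fin n) (ω : Ω n) (t : ℝ≥0) => X n j t ω) (P n)) :
    ∃ (ν : Measure ℝ) (_ : IsProbabilityMeasure ν),
      -- `ν` is the limiting distribution of each Ornstein-Uhlenbeck process
      (∀ n (j : Fin n),
        TendstoInDistribution (X n j) atTop (id : ℝ → ℝ) (fun _ => P n) ν) ∧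
      -- the maximum of the `n` processes converges in total variation to its limiting law
      (∀ n, 1 ≤ n →
        Tendsto (fun t : ℝ≥0 => tvDist (maxLaw (X n) (P n) t) (iidMaxLaw n ν)) atTop (𝓝 0)) ∧
      -- profile cut-off
      ∀ (κ : ℝ) (o : ℕ → ℝ), 0 < κ → Tendsto o atTop (𝓝 0) →
        HasProfileCutoff
          (fun n t => tvDist (maxLaw (X n) (P n) t) (iidMaxLaw n ν))
          (fun n => 1 / (2 * lam) * Real.log (Real.log n))
          (fun n => κ + o n)
          (gumbelProfile lam c x₀ κ) := by
  have hdist : ∀ n, 1 ≤ n → ∀ t : ℝ≥0, 0 < t →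
      tvDist (maxLaw (X n) (P n) t) (iidMaxLaw n (gaussianReal 0 (Real.toNNReal (c / lam)))) =
        maxDist (x₀ / √(c / lam)) n (Real.exp (-(lam * t))) := by
    intro n hn t ht
    rw [maxLaw_eq_iidMaxLaw (fun j => (hX n j).choose_spec.2.measurable t)
      ((hindep n).comp (fun _ f => f t) fun _ => measurable_pi_apply t)
      (fun j => (hX n j).map_eq_gaussianReal hlam hc t)]
    refine tvDist_iidMaxLaw_gaussianReal hn (by positivity) ?_
    refine pow_lt_one₀ (Real.exp_pos _).le (Real.exp_lt_one_iff.2 (neg_lt_zero.2 ?_)) two_ne_zero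
    have : (0 : ℝ) < t := ht
    positivity
  refine ⟨gaussianReal 0 (Real.toNNReal (c / lam)), inferInstance,
    fun n j => (hX n j).tendstoInDistribution hlam hc, fun n hn => ?_, fun κ o hκ ho => ?_⟩
  · have hexp : Tendsto (fun t : ℝ≥0 => Real.exp (-(lam * (t : ℝ)))) atTop (𝓝 0) :=
      Real.tendsto_exp_neg_atTop_nhds_zero.comp
        ((NNReal.tendsto_coe_atTop.2 tendsto_id).const_mul_atTop hlam)
    refine (tendsto_maxDist_zero (x₀ / √(c / lam)) hn hexp).congr' ?_
    filter_upwards [eventually_gt_atTop 0] with t ht using (hdist n hn t ht).symm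
  · have hw : Tendsto (fun n => κ + o n) atTop (𝓝 κ) := by simpa using ho.const_add κ
    have hp (b : ℝ) : IsProbabilityMeasure (gumbel.map fun ξ => √(2 * lam / c) *
        Real.exp (-(lam * κ * b)) * x₀ - Real.exp (-(2 * lam * κ * b)) + ξ) :=
      Measure.isProbabilityMeasure_map (by fun_prop)
    refine ⟨tendsto_cutoffTime hlam, hw.div_atTop (tendsto_cutoffTime hlam),
      fun b => ⟨tvDist_nonneg _ _, tvDist_le_one _ _⟩, fun b => ?_,
      tendsto_gumbelProfile_atBot hlam hκ, tendsto_gumbelProfile_atTop hlam hκ⟩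
    have hpos : ∀ᶠ n : ℕ in atTop,
        0 < 1 / (2 * lam) * Real.log (Real.log n) + b * (κ + o n) :=
      ((tendsto_cutoffTime hlam).atTop_add (hw.const_mul b)).eventually_gt_atTop 0
    have hlim := tendsto_maxDist_gumbel (x₀ / √(c / lam))
      (tendsto_maxRate_mul_exp (κ := κ) (b := b) hlam ho)
    have hshift : x₀ / √(c / lam) * (√2 * Real.exp (-(lam * κ * b))) -
        (√2 * Real.exp (-(lam * κ * b))) ^ 2 / 2 =
        √(2 * lam / c) * Real.exp (-(lam * κ * b)) * x₀ - Real.exp (-(2 * lam * κ * b)) := by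
      have h1 : √(2 * lam / c) = √2 / √(c / lam) := by
        rw [← Real.sqrt_div zero_le_two, div_div_eq_mul_div]
      rw [h1, mul_pow, Real.sq_sqrt zero_le_two, ← Real.exp_nat_mul,
        show -(2 * lam * κ * b) = ((2 : ℕ) : ℝ) * -(lam * κ * b) by push_cast; ring]
      ring
    rw [hshift] at hlim
    refine hlim.congr' ?_
    filter_upwards [hpos, eventually_ge_atTop 1] with n hn hn1
    rw [hdist n hn1 _ (Real.toNNReal_pos.2 hn), Real.coe_toNNReal _ hn.le]
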